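/- Let $d\ge 1$, let $\xi$ be a random vector in $\mathbb{R}^p$ with law $P_\xi$, and let $F:\mathbb{R}^d\times\mathbb{R}^p\to\mathbb{R}$ be a Carathéodory function, i.e. $F(w,\cdot)$ is Borel measurable for every $w$ and $F(\cdot,\xi)$ is continuous for every $\xi$, with $F(w,\xi)$ integrable for every $w$. Suppose that for almost every $\xi$ the function $F(\cdot,\xi)$ is $C(\xi)$-Lipschitz on $\mathbb{R}^d$ (Euclidean norm), where $C$ is measurable, $Q:=\mathbb{E}[C(\xi)^2]<\infty$ and $L_0:=\mathbb{E}[C(\xi)]>0$. Put $f(w):=\mathbb{E}[F(w,\xi)]$ and assume that $f$ attains its global minimum at a point $x^*$. Let $\widetilde\nabla F:\mathbb{R}^d\times\mathbb{R}^p\to\mathbb{R}^d$ be an approximate stochastic gradient: a Borel measurable function that equals $\nabla_w F(w,\xi)$ at almost every $(w,\xi)$ (for Lebesgue measure times $P_\xi$) at which this gradient exists. Let $K\in\mathbb{Z}_{>0}$, $\beta\in(0,1)$, $\theta>0$, $S=\lceil K^{1-\beta}\rceil$, $\sigma=\theta\sqrt d\,K^{-\beta}$, $\eta=\frac{\theta}{L_0}K^{-\beta}$,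 let $x^1\in\mathbb{R}^d$ and $\Delta:=f(x^1)-f(x^*)$. Perturbed Iterate SGD (PISGD) draws $R$ uniformly from $\{1,\dots,K\}$ and, for $k=1,\dots,R-1$, sets $$x^{k+1}=x^k-\frac{\eta}{S}\sum_{l=1}^S\widetilde\nabla F(x^k+z^k_l,\xi^k_l),$$ where the $z^k_l$ are uniformly distributed on the closed Euclidean ball $B(\sigma)$ of radius $\sigma$ centred at $0$, the $\xi^k_l$ have law $P_\xi$, and $R$ and all the $z^k_l$, $\xi^k_l$ are mutually independent; its output is $x^R$. For a Lebesgue-null set $N$ let $$\partial f(w)=\mathrm{co}\Bigl\{\lim_{i\to\infty}\nabla f(w_i):\ w_i\to w,\ w_i\notin N,\ f\text{ differentiable at }w_i\Bigr\}$$ be the Clarke subdifferential (which does not depend on the choice of $N$), and let $\partial_\sigma f(w)=\mathrm{co}\bigcup_{\|\hat w-w\|_2\le\sigma}\partial f(\hat w)$ be the Clarke $\sigma$-subdifferential. Then $\partial_\sigma f(w)$ is nonempty for every $w$, the random variable $\mathrm{dist}(0,\partial_\sigma f(x^R))$ is integrable, and $$\mathbb{E}\bigl[\mathrm{dist}(0,\partial_\sigma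 f(x^R))\bigr]<K^{\frac{\beta-1}{2}}\sqrt{2\Bigl(\frac{L_0}{\theta}\Delta+L_0^2\sqrt d\,K^{-\beta}+Q\Bigr)}.$$ -/

import Mathlib

open MeasureTheory ProbabilityTheory Filter
open scoped Topology

noncomputable section

/-- `F(w, ξ)` is a Carathéodory function: Borel measurable in `ξ` for every `w` and continuous
in `w` for every `ξ`. -/
structure IsCaratheodory {d p : ℕ}
    (F : EuclideanSpace ℝ (Fin d) → EuclideanSpace ℝ (Fin p) → ℝ) : Prop where
  measurable_right : ∀ w, Measurable (F w)
  continuous_left : ∀ ξ, Continuous fun w => F w ξ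

/-- The objective `f(w) = 𝔼_ξ[F(w, ξ)]`, where `ν` is the law of `ξ`. -/
def objective {d p : ℕ} (F : EuclideanSpace ℝ (Fin d) → EuclideanSpace ℝ (Fin p) → ℝ)
    (ν : Measure (EuclideanSpace ℝ (Fin p))) (w : EuclideanSpace ℝ (Fin d)) : ℝ :=
  ∫ ξ, F w ξ ∂ν

/-- An approximate stochastic gradient of `F`: a jointly Borel measurable function which equals
the gradient of `F(·, ξ)` at `w` for (Lebesgue ⊗ law of `ξ`)-almost every `(w, ξ)` at which that
gradient exists. -/
structure IsApproxStochGradient {d p : ℕ}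
    (F : EuclideanSpace ℝ (Fin d) → EuclideanSpace ℝ (Fin p) → ℝ)
    (ν : Measure (EuclideanSpace ℝ (Fin p)))
    (G : EuclideanSpace ℝ (Fin d) → EuclideanSpace ℝ (Fin p) → EuclideanSpace ℝ (Fin d)) :
    Prop where
  measurable : Measurable fun q : EuclideanSpace ℝ (Fin d) × EuclideanSpace ℝ (Fin p) => G q.1 q.2
  eq_gradient : ∀ᵐ q : EuclideanSpace ℝ (Fin d) × EuclideanSpace ℝ (Fin p)
    ∂((volume : Measure (EuclideanSpace ℝ (Fin d))).prod ν),
      DifferentiableAt ℝ (fun w => F w q.2) q.1 →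
        G q.1 q.2 = gradient (fun w => F w q.2) q.1

/-- The Clarke subdifferential of a locally Lipschitz function `f` at `w`: the convex hull of all
limits of gradients of `f` along sequences that tend to `w`, stay in the set where `f` is
differentiable and avoid the set `N`. For Lebesgue-null `N` this set does not depend on `N`. -/
def clarkeSubdifferential {d : ℕ} (N : Set (EuclideanSpace ℝ (Fin d)))
    (f : EuclideanSpace ℝ (Fin d) → ℝ) (w : EuclideanSpace ℝ (Fin d)) :
    Set (EuclideanSpace ℝ (Fin d)) :=
  convexHull ℝ {g | ∃ u : ℕ → EuclideanSpace ℝ (Fin d),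
    Tendsto u atTop (𝓝 w) ∧ (∀ i, u i ∉ N ∧ DifferentiableAt ℝ f (u i)) ∧
      Tendsto (fun i => gradient f (u i)) atTop (𝓝 g)}

/-- The Clarke `ε`-subdifferential: the convex hull of the union of the Clarke subdifferentials
over the closed Euclidean ball of radius `ε` around `w`. -/
def clarkeEpsSubdifferential {d : ℕ} (N : Set (EuclideanSpace ℝ (Fin d))) (ε : ℝ)
    (f : EuclideanSpace ℝ (Fin d) → ℝ) (w : EuclideanSpace ℝ (Fin d)) :
    Set (EuclideanSpace ℝ (Fin d)) :=
  convexHull ℝ (⋃ u ∈ Metric.closedBall w ε, clarkeSubdifferential N f u)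

/-- A run of Perturbed Iterate SGD on a probability space `(Ω, μ)`, started at `x₁`, with maximal
iteration count `K`, sample size `S`, step size `η` and perturbation level `σ`: the index `R` is
uniform on `{1, …, K}`, the perturbations `z k l` are uniform on the closed ball of radius `σ`, the
samples `ξ k l` have law `ν`, for `1 ≤ k < K` and `l = 1, …, S`, and all of these random variables
are mutually independent. The iterates are `x 1, …, x R`. -/
structure IsPISGDRun {d p : ℕ} {Ω : Type*} [MeasurableSpace Ω] (μ : Measure Ω)
    (G : EuclideanSpace ℝ (Fin d) → EuclideanSpace ℝ (Fin p) → EuclideanSpace ℝ (Fin d))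
    (ν : Measure (EuclideanSpace ℝ (Fin p))) (x₁ : EuclideanSpace ℝ (Fin d))
    (K S : ℕ) (η σ : ℝ) (R : Ω → ℕ)
    (z : ℕ → Fin S → Ω → EuclideanSpace ℝ (Fin d))
    (ξ : ℕ → Fin S → Ω → EuclideanSpace ℝ (Fin p))
    (x : ℕ → Ω → EuclideanSpace ℝ (Fin d)) : Prop where
  measurable_R : Measurable R
  law_R : μ.map R = uniformOn (Set.Icc 1 K)
  measurable_z : ∀ k ∈ Set.Ico 1 K, ∀ l, Measurable (z k l)
  law_z : ∀ k ∈ Set.Ico 1 K, ∀ l, μ.map (z k l) =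
    ProbabilityTheory.cond (volume : Measure (EuclideanSpace ℝ (Fin d))) (Metric.closedBall 0 σ)
  measurable_ξ : ∀ k ∈ Set.Ico 1 K, ∀ l, Measurable (ξ k l)
  law_ξ : ∀ k ∈ Set.Ico 1 K, ∀ l, μ.map (ξ k l) = ν
  /-- The two halves of each pair `(z k l, ξ k l)` are independent, … -/
  indep_z_ξ : ∀ k ∈ Set.Ico 1 K, ∀ l, IndepFun (z k l) (ξ k l) μ
  /-- … the pairs are mutually independent, … -/
  indep_pairs : iIndepFun
    (fun (i : Set.Ico 1 K × Fin S) ω => (z i.1 i.2 ω, ξ i.1 i.2 ω)) μ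
  /-- … and `R` is independent of the whole family of pairs. -/
  indep_R : IndepFun R
    (fun ω (i : Set.Ico 1 K × Fin S) => (z i.1 i.2 ω, ξ i.1 i.2 ω)) μ
  init : ∀ ω, x 1 ω = x₁
  step : ∀ ω, ∀ k, 1 ≤ k → k < R ω →
    x (k + 1) ω = x k ω - (η / S) • ∑ l : Fin S, G (x k ω + z k l ω) (ξ k l ω)

end

/-! The algorithm is plain minibatch SGD on the smoothed objective `ballSmoothing`, the average of
`f` over balls of radius `σ`. Three facts carry the proof. The smoothed objective is differentiable
with gradient `ballGradient`, the ball average of `gradient f`, and the perturbed stochastic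
gradient is an unbiased estimator of it (`integral_approxGradient_eq_ballGradient`). By Rademacher
gradients exist almost everywhere, and the perturbation makes the query point absolutely continuous,
so exceptional null sets are never seen. This average is Lipschitz with constant `M = L₀√d/σ`
(`norm_ballGradient_sub_le`), because two nearby balls differ only in thin lunes. The parameters
satisfy `M * η = 1`, so the descent lemma with minibatch variance at most `Q/S` telescopes over the
iterates and bounds the mean of `‖ballGradient‖ ^ 2` at the uniformly drawn output
(`lintegral_norm_gradient_sgdIterate_le`). An average of gradients over the ball of radius `σ` lies
in the closed convex hull of those gradients, so its norm dominates the distance from `0` to the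
Clarke `σ`-subdifferential (`infDist_clarkeEpsSubdifferential_le`). Jensen's inequality then turns
the second moment into the stated first moment. Measurability of the distance comes from its lower
semicontinuity. -/

noncomputable section

/-! ### Volumes of Euclidean balls, their set differences, and averages over balls. -/

/-- Log-convexity of Γ at the midpoint of `s` and `s + 1`, combined with Γ(s + 1) = sΓ(s). -/
lemma Real.Gamma_add_half_le {s : ℝ} (hs : 0 < s) :
    Real.Gamma (s + 1 / 2) ≤ √s * Real.Gamma s := by
  have h := Real.Gamma_mul_add_mul_le_rpow_Gamma_mul_rpow_Gamma (s := s) (t := s + 1)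
    (a := 1 / 2) (b := 1 / 2) hs (by linarith) (by norm_num) (by norm_num) (by norm_num)
  have hΓ := Real.Gamma_pos_of_pos hs
  rw [Real.Gamma_add_one hs.ne', Real.mul_rpow hs.le hΓ.le, ← Real.sqrt_eq_rpow,
    ← Real.sqrt_eq_rpow] at h
  calc Real.Gamma (s + 1 / 2) = Real.Gamma (1 / 2 * s + 1 / 2 * (s + 1)) := by congr 1; ring
    _ ≤ _ := h
    _ = √s * (√(Real.Gamma s) * √(Real.Gamma s)) := by ring
    _ = _ := by rw [Real.mul_self_sqrt hΓ.le]

lemma two_mul_Gamma_le_sqrt_mul_Gamma (n : ℕ) :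
    2 * Real.Gamma (((n + 1 : ℕ) : ℝ) / 2 + 1) ≤
      √(n + 1 : ℕ) * √Real.pi * Real.Gamma ((n : ℝ) / 2 + 1) := by
  -- Equality holds for `n = 0`, where the midpoint bound is too weak. For `n ≥ 1` that bound
  -- reduces the claim to `2n + 4 ≤ (n + 1)π`.
  rcases n.eq_zero_or_pos with rfl | hn
  · have : Real.Gamma (1 / 2 + 1) = 1 / 2 * √Real.pi := by
      rw [Real.Gamma_add_one (by norm_num), Real.Gamma_one_half_eq]
    norm_num at this ⊢
    rw [this]; linarith
  · have h1 : (1 : ℝ) ≤ n := by exact_mod_cast hn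
    have hs : 0 < (n : ℝ) / 2 + 1 := by positivity
    have h := Real.Gamma_add_half_le hs
    have hΓ := Real.Gamma_pos_of_pos hs
    have e : ((n + 1 : ℕ) : ℝ) / 2 + 1 = (n : ℝ) / 2 + 1 + 1 / 2 := by push_cast; ring
    have key : 2 * √((n : ℝ) / 2 + 1) ≤ √(n + 1 : ℕ) * √Real.pi := by
      rw [← Real.sqrt_mul (by positivity)]
      refine Real.le_sqrt_of_sq_le ?_
      rw [mul_pow, Real.sq_sqrt hs.le]
      push_cast
      nlinarith [Real.pi_gt_d2]
    rw [e]
    calc _ ≤ 2 * (√((n : ℝ) / 2 + 1) * Real.Gamma ((n : ℝ) / 2 + 1)) := by gcongr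
      _ = (2 * √((n : ℝ) / 2 + 1)) * Real.Gamma ((n : ℝ) / 2 + 1) := by ring
      _ ≤ _ := by gcongr

lemma EuclideanSpace.volume_real_closedBall (n : ℕ) (x : EuclideanSpace ℝ (Fin n)) {r : ℝ}
    (hr : 0 ≤ r) :
    volume.real (Metric.closedBall x r) =
      r ^ n * (√Real.pi ^ n / Real.Gamma ((n : ℝ) / 2 + 1)) := by
  rcases n.eq_zero_or_pos with rfl | hn
  · have h1 : Metric.closedBall x r = Set.univ :=
      Set.eq_univ_of_forall fun y => by simp [Subsingleton.elim y x, hr]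
    have h2 := (EuclideanSpace.volume_preserving_symm_measurableEquiv_toLp (Fin 0)).measure_preimage
      (s := Set.univ) MeasurableSet.univ.nullMeasurableSet
    rw [Set.preimage_univ] at h2
    rw [h1, measureReal_def, h2, volume_pi, Measure.pi_of_empty]
    simp
  · have : Nonempty (Fin n) := ⟨⟨0, hn⟩⟩
    have hΓ := Real.Gamma_pos_of_pos (show (0 : ℝ) < (n : ℝ) / 2 + 1 by positivity)
    rw [measureReal_def, EuclideanSpace.volume_closedBall]
    simp only [Fintype.card_fin, ENNReal.toReal_mul, ENNReal.toReal_pow]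
    rw [ENNReal.toReal_ofReal hr, ENNReal.toReal_ofReal (by positivity)]

/-- Compares a ball with its equatorial section; the factor 2 will pay for the two lunes of a
symmetric difference. Dimension `n = 0` matters as the section when `d = 1`. -/
lemma two_mul_volume_real_closedBall_le (n : ℕ) {r : ℝ} (hr : 0 < r) :
    2 * volume.real (Metric.closedBall (0 : EuclideanSpace ℝ (Fin n)) r) ≤
      √(n + 1 : ℕ) / r * volume.real (Metric.closedBall (0 : EuclideanSpace ℝ (Fin (n + 1))) r) := by
  rw [EuclideanSpace.volume_real_closedBall n _ hr.le,
    EuclideanSpace.volume_real_closedBall (n + 1) _ hr.le]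
  have h := two_mul_Gamma_le_sqrt_mul_Gamma n
  have h1 := Real.Gamma_pos_of_pos (show (0 : ℝ) < (n : ℝ) / 2 + 1 by positivity)
  have h2 := Real.Gamma_pos_of_pos (show (0 : ℝ) < ((n + 1 : ℕ) : ℝ) / 2 + 1 by positivity)
  have e1 : 2 * (r ^ n * (√Real.pi ^ n / Real.Gamma ((n : ℝ) / 2 + 1))) =
      r ^ n * √Real.pi ^ n * (2 / Real.Gamma ((n : ℝ) / 2 + 1)) := by ring
  have e2 : √(n + 1 : ℕ) / r * (r ^ (n + 1) * (√Real.pi ^ (n + 1) /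
      Real.Gamma (((n + 1 : ℕ) : ℝ) / 2 + 1))) = r ^ n * √Real.pi ^ n *
      ((√(n + 1 : ℕ) * √Real.pi) / Real.Gamma (((n + 1 : ℕ) : ℝ) / 2 + 1)) := by
    rw [pow_succ, pow_succ]
    generalize √(n + 1 : ℕ) = A
    field_simp
  rw [e1, e2]
  refine mul_le_mul_of_nonneg_left ?_ (by positivity)
  rw [div_le_div_iff₀ h1 h2]
  exact h

/-- The part of a ball not covered by a translate of it is bounded by the volume of the cylinder
over the ball's shadow. -/
lemma volume_closedBall_sdiff_closedBall_le (n : ℕ) (x y : EuclideanSpace ℝ (Fin (n + 1))) {r : ℝ}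
    (hr : 0 ≤ r) :
    volume (Metric.closedBall x r \ Metric.closedBall y r) ≤
      ENNReal.ofReal ‖x - y‖ * volume (Metric.closedBall (0 : EuclideanSpace ℝ (Fin n)) r) := by
  rcases eq_or_ne x y with rfl | hxy
  · simp
  set a := ‖x - y‖ with ha
  have ha0 : 0 < a := norm_pos_iff.2 (sub_ne_zero.2 hxy)
  -- In an orthonormal basis whose zeroth vector points along `x - y`, with origin `y`, the centre
  -- `x` becomes `a` times that vector, and the lune can be sliced parallel to it.
  obtain ⟨b, hb⟩ := Orthonormal.exists_orthonormalBasis_extension_of_card_eq (𝕜 := ℝ)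
    (E := EuclideanSpace ℝ (Fin (n + 1))) (ι := Fin (n + 1)) (by simp)
    (v := fun _ => a⁻¹ • (x - y)) (s := {0}) (by
      constructor
      · rintro ⟨i, hi⟩
        simp [norm_smul, ← ha, abs_of_pos ha0, ha0.ne']
      · rintro ⟨i, hi⟩ ⟨j, hj⟩ hij
        exact absurd (Subtype.ext (hi.trans hj.symm)) hij)
  have hb0 : x - y = a • b 0 := by
    rw [hb 0 rfl, smul_smul, mul_inv_cancel₀ ha0.ne', one_smul]
  let M : EuclideanSpace ℝ (Fin (n + 1)) → ℝ × (Fin n → ℝ) := fun w =>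
    MeasurableEquiv.piFinSuccAbove (fun _ => ℝ) 0
      ((MeasurableEquiv.toLp 2 (Fin (n + 1) → ℝ)).symm (b.repr (w - y)))
  have hM : MeasurePreserving M volume volume :=
    (volume_preserving_piFinSuccAbove (fun _ => ℝ) 0).comp
      ((EuclideanSpace.volume_preserving_symm_measurableEquiv_toLp _).comp
        (b.measurePreserving_repr.comp (measurePreserving_sub_right volume y)))
  have hM1 : ∀ w, (M w).1 = b.repr (w - y) 0 := fun w => rfl
  have hM2 : ∀ w i, (M w).2 i = b.repr (w - y) i.succ := fun w i => rfl
  have hy : ∀ w, ‖w - y‖ ^ 2 = (M w).1 ^ 2 + ∑ i, (M w).2 i ^ 2 := fun w => by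
    rw [← b.repr.norm_map, EuclideanSpace.norm_sq_eq, Fin.sum_univ_succ]
    simp [hM1, hM2]
  have hx : ∀ w, ‖w - x‖ ^ 2 = ((M w).1 - a) ^ 2 + ∑ i, (M w).2 i ^ 2 := fun w => by
    have : w - x = (w - y) - a • b 0 := by rw [← hb0]; abel
    rw [this, ← b.repr.norm_map, EuclideanSpace.norm_sq_eq, Fin.sum_univ_succ]
    simp [hM1, hM2]
  let T : Set (ℝ × (Fin n → ℝ)) :=
    {q | (q.1 - a) ^ 2 + ∑ i, q.2 i ^ 2 ≤ r ^ 2} ∩ {q | r ^ 2 < q.1 ^ 2 + ∑ i, q.2 i ^ 2}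
  have hT : MeasurableSet T :=
    (measurableSet_le (by fun_prop) (by fun_prop)).inter
      (measurableSet_lt (by fun_prop) (by fun_prop))
  have hpre : Metric.closedBall x r \ Metric.closedBall y r = M ⁻¹' T := by
    ext w
    simp only [Set.mem_sdiff, Metric.mem_closedBall, dist_eq_norm, not_le, Set.mem_preimage, T,
      Set.mem_inter_iff, Set.mem_ofPred_eq, ← hx, ← hy]
    rw [sq_le_sq₀ (norm_nonneg _) hr, sq_lt_sq₀ hr (norm_nonneg _)]
  let B : Set (Fin n → ℝ) := {v | ∑ i, v i ^ 2 ≤ r ^ 2}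
  have hB : MeasurableSet B := measurableSet_le (by fun_prop) (by fun_prop)
  have hBvol : volume B = volume (Metric.closedBall (0 : EuclideanSpace ℝ (Fin n)) r) := by
    rw [← (EuclideanSpace.volume_preserving_symm_measurableEquiv_toLp (Fin n)).measure_preimage
      hB.nullMeasurableSet]
    congr 1
    ext w
    simp only [Set.mem_preimage, B, Set.mem_ofPred_eq, Metric.mem_closedBall, dist_zero_right]
    rw [← sq_le_sq₀ (norm_nonneg _) hr, EuclideanSpace.norm_sq_eq]
    simp
  rw [hpre, hM.measure_preimage hT.nullMeasurableSet, ← hBvol, Measure.volume_eq_prod,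
    Measure.prod_apply_symm hT]
  calc ∫⁻ v, volume ((fun t => (t, v)) ⁻¹' T)
      ≤ ∫⁻ v, B.indicator (fun _ => ENNReal.ofReal a) v := by
        refine lintegral_mono fun v => ?_
        by_cases hv : v ∈ B
        · rw [Set.indicator_of_mem hv]
          set c := √(r ^ 2 - ∑ i, v i ^ 2) with hc
          have hc0 : 0 ≤ c := Real.sqrt_nonneg _
          have hc2 : c ^ 2 = r ^ 2 - ∑ i, v i ^ 2 := Real.sq_sqrt (sub_nonneg.2 hv)
          -- On a slice the two balls are `|t - a| ≤ c` and `|t| ≤ c`; since `a > 0`, a point of the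
          -- first outside the second must exceed `c`.
          calc _ ≤ volume (Set.Ioc c (c + a)) := by
                refine measure_mono ?_
                rintro t ⟨h1, h2⟩
                simp only [Set.mem_ofPred_eq] at h1 h2
                have h3 : |t - a| ≤ c := abs_le_of_sq_le_sq (by linarith) hc0
                have h4 : c < |t| := by
                  rw [← abs_of_nonneg hc0, ← sq_lt_sq]; linarith
                rw [abs_le] at h3
                rcases abs_cases t with ⟨h5, _⟩ | ⟨h5, _⟩
                · exact ⟨by linarith, by linarith⟩
                · exact absurd h4 (by linarith)
            _ = _ := by simp
        · rw [Set.indicator_of_notMem hv]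
          refine le_of_eq (measure_mono_null (t := ∅) ?_ measure_empty)
          rintro t ⟨h1, -⟩
          exact hv (le_trans (le_add_of_nonneg_left (sq_nonneg (t - a))) h1)
    _ = ENNReal.ofReal a * volume B := by
        rw [lintegral_indicator hB, lintegral_const, Measure.restrict_apply_univ]

lemma two_mul_volume_real_closedBall_sdiff_le {d : ℕ} (hd : 0 < d) (x y : EuclideanSpace ℝ (Fin d))
    {r : ℝ} (hr : 0 < r) :
    2 * volume.real (Metric.closedBall x r \ Metric.closedBall y r) ≤
      √d / r * ‖x - y‖ * volume.real (Metric.closedBall (0 : EuclideanSpace ℝ (Fin d)) r) := by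
  obtain ⟨n, rfl⟩ : ∃ n, d = n + 1 := ⟨d - 1, by omega⟩
  have h1 := ENNReal.toReal_mono (ENNReal.mul_ne_top ENNReal.ofReal_ne_top
    measure_closedBall_lt_top.ne) (volume_closedBall_sdiff_closedBall_le n x y hr.le)
  rw [ENNReal.toReal_mul, ENNReal.toReal_ofReal (norm_nonneg _)] at h1
  have h2 := two_mul_volume_real_closedBall_le n hr
  simp only [measureReal_def] at *
  nlinarith [norm_nonneg (x - y), mul_le_mul_of_nonneg_left h2 (norm_nonneg (x - y))]

lemma volume_real_closedBall_pos {d : ℕ} (x : EuclideanSpace ℝ (Fin d)) {r : ℝ} (hr : 0 < r) :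
    0 < volume.real (Metric.closedBall x r) :=
  ENNReal.toReal_pos (Metric.measure_closedBall_pos volume x hr).ne' measure_closedBall_lt_top.ne

/-- Averaging a bounded field over balls of radius `r` makes it Lipschitz. -/
lemma norm_setIntegral_closedBall_sub_le {d : ℕ} (hd : 0 < d)
    {h : EuclideanSpace ℝ (Fin d) → EuclideanSpace ℝ (Fin d)} (hm : Measurable h) {L : ℝ}
    (hL : ∀ w, ‖h w‖ ≤ L) {r : ℝ} (hr : 0 < r) (x y : EuclideanSpace ℝ (Fin d)) :
    ‖(∫ u in Metric.closedBall x r, h u) - ∫ u in Metric.closedBall y r, h u‖ ≤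
      volume.real (Metric.closedBall (0 : EuclideanSpace ℝ (Fin d)) r) *
        (L * √d / r * ‖x - y‖) := by
  have hL0 : 0 ≤ L := (norm_nonneg _).trans (hL 0)
  have hi : ∀ s : Set (EuclideanSpace ℝ (Fin d)), volume s ≠ ⊤ → IntegrableOn h s := fun s hs =>
    Measure.integrableOn_of_bounded hs hm.aestronglyMeasurable (M := L)
      (Eventually.of_forall hL)
  have split : ∀ x y : EuclideanSpace ℝ (Fin d), ∫ u in Metric.closedBall x r, h u =
      (∫ u in Metric.closedBall x r ∩ Metric.closedBall y r, h u) +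
        ∫ u in Metric.closedBall x r \ Metric.closedBall y r, h u := fun x y =>
    (integral_inter_add_sdiff Metric.isClosed_closedBall.measurableSet
      (hi _ measure_closedBall_lt_top.ne)).symm
  have bd : ∀ x y : EuclideanSpace ℝ (Fin d),
      ‖∫ u in Metric.closedBall x r \ Metric.closedBall y r, h u‖ ≤
        L * volume.real (Metric.closedBall x r \ Metric.closedBall y r) := fun x y =>
    norm_setIntegral_le_of_norm_le_const
      ((measure_mono Set.sdiff_subset).trans_lt measure_closedBall_lt_top) (fun u _ => hL u)
  -- The integrals over the common part cancel, and each remaining lune contributes half of the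
  -- bound.
  rw [split x y, split y x, Set.inter_comm (Metric.closedBall y r), add_sub_add_left_eq_sub]
  have h1 := two_mul_volume_real_closedBall_sdiff_le hd x y hr
  have h2 := two_mul_volume_real_closedBall_sdiff_le hd y x hr
  rw [norm_sub_rev y x] at h2
  refine (norm_sub_le _ _).trans ((add_le_add (bd x y) (bd y x)).trans ?_)
  rw [← mul_add]
  calc _ ≤ L * (√d / r * ‖x - y‖ *
        volume.real (Metric.closedBall (0 : EuclideanSpace ℝ (Fin d)) r)) := by
        gcongr; linarith
    _ = _ := by ring

/-! ### Measurability of differentiability, and differentiation under the integral. -/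

/-- A family of continuous functions that is pointwise measurable in the parameter is measurable as
a map into the space of continuous functions. -/
lemma ContinuousMap.measurable_of_forall_eval {X T : Type*} [PseudoMetricSpace X]
    [SecondCountableTopology X] [LocallyCompactSpace X] [MeasurableSpace T]
    (f : T → C(X, ℝ)) (hf : ∀ w, Measurable fun t => f t w) :
    Measurable[_, borel C(X, ℝ)] f := by
  rw [borel_eq_generateFrom_of_subbasis (α := C(X, ℝ)) rfl]
  refine measurable_generateFrom ?_
  rintro _ ⟨K, hK, U, hU, rfl⟩
  -- This case is separate because `Metric.infDist` to the empty set is `0`.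
  rcases eq_or_ne Uᶜ ∅ with hU' | hU'
  · rw [Set.compl_empty_iff] at hU'
    subst hU'
    simp [Set.mapsTo_univ]
  obtain ⟨D, hDK, hDc, hD⟩ := TopologicalSpace.IsSeparable.exists_countable_dense_subset
    (TopologicalSpace.IsSeparable.of_separableSpace K)
  have hne : Uᶜ.Nonempty := Set.nonempty_iff_ne_empty.2 hU'
  -- By compactness, mapping `K` into `U` means staying a uniform distance from `Uᶜ`, which by
  -- continuity need only be tested on a countable dense subset of `K`.
  have : f ⁻¹' {g | Set.MapsTo g K U} = ⋃ n : ℕ, ⋂ w ∈ D,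
      {t | 1 / ((n : ℝ) + 1) ≤ Metric.infDist (f t w) Uᶜ} := by
    ext t
    simp only [Set.mem_preimage, Set.mem_ofPred_eq, Set.mem_iUnion, Set.mem_iInter]
    constructor
    · intro h
      rcases K.eq_empty_or_nonempty with rfl | hKne
      · exact ⟨0, fun w hw => (hDK hw).elim⟩
      obtain ⟨w₀, hw₀, hmin⟩ := hK.exists_isMinOn hKne
        (f := fun w => Metric.infDist (f t w) Uᶜ)
        ((Metric.continuous_infDist_pt _).comp (f t).continuous).continuousOn
      have hpos : 0 < Metric.infDist (f t w₀) Uᶜ :=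
        ((show IsOpen U from hU).isClosed_compl.notMem_iff_infDist_pos hne).1 (by simpa using h hw₀)
      obtain ⟨n, hn⟩ := exists_nat_one_div_lt hpos
      exact ⟨n, fun w hw => hn.le.trans (hmin (hDK hw))⟩
    · rintro ⟨n, hn⟩ w hw
      have hcl : IsClosed {w | 1 / ((n : ℝ) + 1) ≤ Metric.infDist (f t w) Uᶜ} :=
        isClosed_le continuous_const
          ((Metric.continuous_infDist_pt _).comp (f t).continuous)
      have h1 := (closure_minimal (s := D) hn hcl) (hD hw)
      by_contra hwU
      have h2 : Metric.infDist (f t w) Uᶜ = 0 := Metric.infDist_zero_of_mem hwU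
      have h3 : 1 / ((n : ℝ) + 1) ≤ 0 := h2 ▸ h1
      have : 0 < 1 / ((n : ℝ) + 1) := by positivity
      linarith
  rw [this]
  refine MeasurableSet.iUnion fun n => MeasurableSet.biInter hDc fun w _ => ?_
  exact measurableSet_le measurable_const
    ((Metric.continuous_infDist_pt _).measurable.comp (hf w))

section
variable {d p : ℕ} {F : EuclideanSpace ℝ (Fin d) → EuclideanSpace ℝ (Fin p) → ℝ}

lemma IsCaratheodory.measurable_uncurry (hF : IsCaratheodory F) :
    Measurable fun q : EuclideanSpace ℝ (Fin d) × EuclideanSpace ℝ (Fin p) => F q.1 q.2 :=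
  measurable_uncurry_of_continuous_of_measurable hF.continuous_left hF.measurable_right

/-- `F` need not be continuous in `ξ`, so the function itself serves as parameter: evaluation on
`C(ℝ^d, ℝ) × ℝ^d` is continuous, its differentiability set is Borel, and the set in question is a
measurable preimage of it. -/
lemma IsCaratheodory.measurableSet_differentiableAt (hF : IsCaratheodory F) :
    MeasurableSet {q : EuclideanSpace ℝ (Fin d) × EuclideanSpace ℝ (Fin p) |
      DifferentiableAt ℝ (fun w => F w q.2) q.1} := by
  let Φ : EuclideanSpace ℝ (Fin p) → C(EuclideanSpace ℝ (Fin d), ℝ) :=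
    fun t => ⟨fun w => F w t, hF.continuous_left t⟩
  let _ : MeasurableSpace C(EuclideanSpace ℝ (Fin d), ℝ) := borel _
  have _ : BorelSpace C(EuclideanSpace ℝ (Fin d), ℝ) := ⟨rfl⟩
  have hΦ : Measurable Φ := ContinuousMap.measurable_of_forall_eval Φ hF.measurable_right
  have h := measurableSet_of_differentiableAt_with_param ℝ
    (f := fun (g : C(EuclideanSpace ℝ (Fin d), ℝ)) w => g w)
    ContinuousEval.continuous_eval
  exact ((hΦ.comp measurable_snd).prodMk measurable_fst) h

variable {ν : Measure (EuclideanSpace ℝ (Fin p))}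
  {C : EuclideanSpace ℝ (Fin p) → ℝ}
  {G : EuclideanSpace ℝ (Fin d) → EuclideanSpace ℝ (Fin p) → EuclideanSpace ℝ (Fin d)}

lemma lipschitzWith_toNNReal_of_abs_sub_le {X : Type*} [NormedAddCommGroup X] {f : X → ℝ} {c : ℝ}
    (h : ∀ w w', |f w - f w'| ≤ c * ‖w - w'‖) : LipschitzWith c.toNNReal f :=
  LipschitzWith.of_dist_le_mul fun w w' => by
    rw [Real.dist_eq, dist_eq_norm]
    exact (h w w').trans (mul_le_mul_of_nonneg_right (Real.le_coe_toNNReal c) (norm_nonneg _))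

lemma norm_gradient_le_of_abs_sub_le (hd : 0 < d) {f : EuclideanSpace ℝ (Fin d) → ℝ} {c : ℝ}
    (h : ∀ w w', |f w - f w'| ≤ c * ‖w - w'‖) (w : EuclideanSpace ℝ (Fin d)) :
    ‖gradient f w‖ ≤ c := by
  -- A unit vector exists because `d > 0`; in dimension 0 the hypothesis would allow negative `c`.
  have hc : 0 ≤ c := by
    have := (abs_nonneg _).trans (h (EuclideanSpace.single ⟨0, hd⟩ 1) 0)
    simpa using this
  rw [gradient, LinearIsometryEquiv.norm_map]
  simpa [hc] using norm_fderiv_le_of_lipschitz ℝ (x₀ := w) (lipschitzWith_toNNReal_of_abs_sub_le h)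

lemma IsApproxStochGradient.measurable_uncurry_shift (hG : IsApproxStochGradient F ν G) :
    Measurable (Function.uncurry fun (y : EuclideanSpace ℝ (Fin d))
      (q : EuclideanSpace ℝ (Fin d) × EuclideanSpace ℝ (Fin p)) => G (y + q.1) q.2) :=
  hG.measurable.comp (g := fun q : EuclideanSpace ℝ (Fin d) × EuclideanSpace ℝ (Fin p) =>
      G q.1 q.2) (f := fun r : EuclideanSpace ℝ (Fin d) ×
        (EuclideanSpace ℝ (Fin d) × EuclideanSpace ℝ (Fin p)) => (r.1 + r.2.1, r.2.2))
      (by fun_prop)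

/-- Almost everywhere the approximate stochastic gradient is the gradient. -/
lemma IsApproxStochGradient.ae_hasGradientAt [SFinite ν] (hF : IsCaratheodory F)
    (hLip : ∀ᵐ t ∂ν, ∀ w w', |F w t - F w' t| ≤ C t * ‖w - w'‖)
    (hG : IsApproxStochGradient F ν G) :
    ∀ᵐ q : EuclideanSpace ℝ (Fin d) × EuclideanSpace ℝ (Fin p)
      ∂((volume : Measure (EuclideanSpace ℝ (Fin d))).prod ν),
      HasGradientAt (fun w => F w q.2) (G q.1 q.2) q.1 := by
  have hD := hF.measurableSet_differentiableAt
  have h1 : ∀ᵐ q : EuclideanSpace ℝ (Fin d) × EuclideanSpace ℝ (Fin p)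
      ∂((volume : Measure (EuclideanSpace ℝ (Fin d))).prod ν),
      DifferentiableAt ℝ (fun w => F w q.2) q.1 := by
    rw [ae_iff]
    change (volume.prod ν) {q : EuclideanSpace ℝ (Fin d) × EuclideanSpace ℝ (Fin p) |
      DifferentiableAt ℝ (fun w => F w q.2) q.1}ᶜ = 0
    -- Fubini reduces the claim to Rademacher's theorem for almost every fixed `ξ`.
    rw [Measure.prod_apply_symm hD.compl, lintegral_eq_zero_iff']
    · filter_upwards [hLip] with t ht
      exact (lipschitzWith_toNNReal_of_abs_sub_le ht).ae_differentiableAt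
    · exact (measurable_measure_prodMk_right hD.compl).aemeasurable
  filter_upwards [h1, hG.eq_gradient] with q hq hq'
  rw [hq' hq]
  exact hq.hasGradientAt

/-- Translation invariance of Lebesgue measure: whatever the current iterate `w`, the perturbed
query point avoids null sets almost surely. -/
lemma MeasureTheory.ae_shift_of_ae_prod [SFinite ν] {τ : Measure (EuclideanSpace ℝ (Fin d))} [SFinite τ]
    (hτ : τ ≪ volume)
    {r : EuclideanSpace ℝ (Fin d) × EuclideanSpace ℝ (Fin p) → Prop}
    (h : ∀ᵐ q ∂((volume : Measure (EuclideanSpace ℝ (Fin d))).prod ν), r q)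
    (w : EuclideanSpace ℝ (Fin d)) : ∀ᵐ q ∂(τ.prod ν), r (w + q.1, q.2) :=
  (hτ.prod Measure.AbsolutelyContinuous.rfl).ae_le
    (((measurePreserving_add_left volume w).prod (MeasurePreserving.id ν)).quasiMeasurePreserving.ae h)

lemma MeasureTheory.ae_shift {τ : Measure (EuclideanSpace ℝ (Fin d))}
    (hτ : τ ≪ volume) {r : EuclideanSpace ℝ (Fin d) → Prop}
    (h : ∀ᵐ q, r q) (w : EuclideanSpace ℝ (Fin d)) : ∀ᵐ z ∂τ, r (w + z) :=
  hτ.ae_le ((measurePreserving_add_left volume w).quasiMeasurePreserving.ae h)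

lemma abs_objective_sub_le (hFint : ∀ w, Integrable (F w) ν) (hC : Integrable C ν)
    (hLip : ∀ᵐ t ∂ν, ∀ w w', |F w t - F w' t| ≤ C t * ‖w - w'‖)
    (w w' : EuclideanSpace ℝ (Fin d)) :
    |objective F ν w - objective F ν w'| ≤ (∫ t, C t ∂ν) * ‖w - w'‖ := by
  rw [objective, objective, ← integral_sub (hFint _) (hFint _), ← integral_mul_const]
  refine (abs_integral_le_integral_abs).trans (integral_mono_ae
    ((hFint _).sub (hFint _)).abs (hC.mul_const _) ?_)
  filter_upwards [hLip] with t ht using ht w w'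

/-- The randomized smoothing of a Lipschitz function is differentiable and its gradient is the
average of the gradients. -/
lemma hasGradientAt_integral_shift {T : Type*} [MeasurableSpace T] {P : Measure T}
    {Z : T → EuclideanSpace ℝ (Fin d)} {Φ : EuclideanSpace ℝ (Fin d) → T → ℝ}
    {Γ : EuclideanSpace ℝ (Fin d) → T → EuclideanSpace ℝ (Fin d)} {c : T → ℝ}
    (hc : Integrable c P)
    (hΦm : ∀ w, AEStronglyMeasurable (fun q => Φ (w + Z q) q) P)
    (hΓm : ∀ w, AEStronglyMeasurable (fun q => Γ (w + Z q) q) P)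
    (hΦi : ∀ w, Integrable (fun q => Φ (w + Z q) q) P)
    (hlip : ∀ᵐ q ∂P, ∀ w w', |Φ w q - Φ w' q| ≤ c q * ‖w - w'‖)
    (w : EuclideanSpace ℝ (Fin d))
    (hgrad : ∀ᵐ q ∂P, HasGradientAt (fun u => Φ u q) (Γ (w + Z q) q) (w + Z q)) :
    HasGradientAt (fun w => ∫ q, Φ (w + Z q) q ∂P) (∫ q, Γ (w + Z q) q ∂P) w := by
  let J := InnerProductSpace.toDual ℝ (EuclideanSpace ℝ (Fin d))
  -- The Lipschitz modulus dominates the difference quotients, so differentiability of almost every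
  -- integrand at the single point `w` suffices.
  have h := hasFDerivAt_integral_of_dominated_loc_of_lip' (μ := P) (𝕜 := ℝ)
    (F := fun w q => Φ (w + Z q) q) (F' := fun q => J (Γ (w + Z q) q)) (x₀ := w) (s := Set.univ)
    (bound := c) univ_mem (fun x _ => hΦm x) (hΦi w)
    (J.continuous.comp_aestronglyMeasurable (hΓm w))
    (by
      filter_upwards [hlip] with q hq x _
      simpa using hq (x + Z q) (w + Z q)) hc
    (by
      filter_upwards [hgrad] with q hq
      have h1 := hq.hasFDerivAt
      have := HasFDerivAt.comp (f := fun u => u + Z q) w h1 ((hasFDerivAt_id w).add_const (Z q))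
      simpa [Function.comp_def] using this)
  rw [hasGradientAt_iff_hasFDerivAt]
  refine h.2.congr_fderiv ?_
  exact (J.toContinuousLinearEquiv.toContinuousLinearMap.integral_comp_comm
    ((J.toContinuousLinearEquiv.integrable_comp_iff).1 h.1))
end

/-! ### The Clarke subdifferential: semicontinuity and averaged gradients. -/

section
variable {d : ℕ} {N : Set (EuclideanSpace ℝ (Fin d))} {f : EuclideanSpace ℝ (Fin d) → ℝ}

/-- The closure of the graph of the gradient of `f` outside `N`. -/
def limitingGradientGraph (N : Set (EuclideanSpace ℝ (Fin d))) (f : EuclideanSpace ℝ (Fin d) → ℝ) :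
    Set (EuclideanSpace ℝ (Fin d) × EuclideanSpace ℝ (Fin d)) :=
  closure ((fun u => (u, gradient f u)) '' {u | u ∉ N ∧ DifferentiableAt ℝ f u})

/-- The limiting gradients of `f` at points of the closed ball of radius `ε` around `w`. -/
def limitingGradients (N : Set (EuclideanSpace ℝ (Fin d))) (ε : ℝ)
    (f : EuclideanSpace ℝ (Fin d) → ℝ) (w : EuclideanSpace ℝ (Fin d)) :
    Set (EuclideanSpace ℝ (Fin d)) :=
  {g | ∃ u ∈ Metric.closedBall w ε, (u, g) ∈ limitingGradientGraph N f}

lemma mem_limitingGradientGraph_iff {u g : EuclideanSpace ℝ (Fin d)} :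
    (u, g) ∈ limitingGradientGraph N f ↔ ∃ v : ℕ → EuclideanSpace ℝ (Fin d),
      Tendsto v atTop (𝓝 u) ∧ (∀ i, v i ∉ N ∧ DifferentiableAt ℝ f (v i)) ∧
        Tendsto (fun i => gradient f (v i)) atTop (𝓝 g) := by
  rw [limitingGradientGraph, mem_closure_iff_seq_limit]
  constructor
  · rintro ⟨q, hq, hlim⟩
    choose v hv hvq using hq
    obtain rfl : q = fun i => (v i, gradient f (v i)) := funext fun i => (hvq i).symm
    exact ⟨v, (continuous_fst.tendsto _).comp hlim, hv, (continuous_snd.tendsto _).comp hlim⟩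
  · rintro ⟨v, h1, h2, h3⟩
    exact ⟨fun i => (v i, gradient f (v i)), fun i => ⟨v i, h2 i, rfl⟩, h1.prodMk_nhds h3⟩

/-- The nested convex hulls collapse into one, taken over a section of a closed graph; this is what
makes compactness arguments available. -/
lemma clarkeEpsSubdifferential_eq_convexHull (ε : ℝ) (w : EuclideanSpace ℝ (Fin d)) :
    clarkeEpsSubdifferential N ε f w = convexHull ℝ (limitingGradients N ε f w) := by
  apply Set.Subset.antisymm
  · refine convexHull_min (Set.iUnion₂_subset fun u hu => convexHull_mono ?_)
      (convex_convexHull ℝ _)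
    exact fun g hg => ⟨u, hu, mem_limitingGradientGraph_iff.2 hg⟩
  · refine convexHull_mono fun g hg => ?_
    obtain ⟨u, hu, hg⟩ := hg
    exact Set.mem_iUnion₂.2 ⟨u, hu, subset_convexHull ℝ _ (mem_limitingGradientGraph_iff.1 hg)⟩

lemma gradient_mem_clarkeEpsSubdifferential {ε : ℝ} {w u : EuclideanSpace ℝ (Fin d)}
    (hu : u ∈ Metric.closedBall w ε) (huN : u ∉ N) (hf : DifferentiableAt ℝ f u) :
    gradient f u ∈ clarkeEpsSubdifferential N ε f w := by
  rw [clarkeEpsSubdifferential_eq_convexHull]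
  exact subset_convexHull ℝ _ ⟨u, hu, subset_closure ⟨u, ⟨huN, hf⟩, rfl⟩⟩

variable {L : ℝ}

lemma norm_le_of_mem_limitingGradientGraph (hd : 0 < d)
    (hf : ∀ w w', |f w - f w'| ≤ L * ‖w - w'‖) {u g : EuclideanSpace ℝ (Fin d)}
    (h : (u, g) ∈ limitingGradientGraph N f) : ‖g‖ ≤ L := by
  obtain ⟨v, -, -, hv⟩ := mem_limitingGradientGraph_iff.1 h
  exact le_of_tendsto hv.norm
    (Eventually.of_forall fun i => norm_gradient_le_of_abs_sub_le hd hf (v i))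

/-- The limiting gradients over a ball depend upper semicontinuously on its centre. -/
lemma eventually_limitingGradients_subset_thickening (hd : 0 < d)
    (hf : ∀ w w', |f w - f w'| ≤ L * ‖w - w'‖) (ε : ℝ) (w : EuclideanSpace ℝ (Fin d)) {δ : ℝ}
    (hδ : 0 < δ) :
    ∀ᶠ w' in 𝓝 w, limitingGradients N ε f w' ⊆ Metric.thickening δ (limitingGradients N ε f w) := by
  by_contra hcon
  obtain ⟨v, hv, hv'⟩ := exists_seq_forall_of_frequently (not_eventually.1 hcon)
  simp only [Set.not_subset] at hv'
  choose g hg hgn using hv'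
  choose u hu hug using hg
  -- Gradients are bounded by `L` and base points stay near `w`, so a subsequence converges;
  -- closedness of the graph puts its limit among the limiting gradients at `w`, contradicting
  -- distance at least `δ`.
  have hb : ∃ᶠ n in atTop, (u n, g n) ∈
      Metric.closedBall w (ε + 1) ×ˢ Metric.closedBall (0 : EuclideanSpace ℝ (Fin d)) L := by
    refine Eventually.frequently ?_
    filter_upwards [hv.eventually (Metric.ball_mem_nhds w one_pos)] with n hn
    refine ⟨?_, by simpa using norm_le_of_mem_limitingGradientGraph hd hf (hug n)⟩
    have h1 := Metric.mem_closedBall.1 (hu n)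
    have h2 := Metric.mem_ball.1 hn
    exact Metric.mem_closedBall.2 ((dist_triangle _ (v n) _).trans (by linarith))
  obtain ⟨⟨u₀, g₀⟩, -, φ, hφ, hlim⟩ := tendsto_subseq_of_frequently_bounded
    (Metric.isBounded_closedBall.prod Metric.isBounded_closedBall) hb
  have hu₀ : Tendsto (fun n => u (φ n)) atTop (𝓝 u₀) := (continuous_fst.tendsto _).comp hlim
  have hg₀ : Tendsto (fun n => g (φ n)) atTop (𝓝 g₀) := (continuous_snd.tendsto _).comp hlim
  have hmem : g₀ ∈ limitingGradients N ε f w := by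
    refine ⟨u₀, ?_, isClosed_closure.mem_of_tendsto hlim (Eventually.of_forall fun n => hug (φ n))⟩
    exact le_of_tendsto (hu₀.dist (hv.comp hφ.tendsto_atTop))
      (Eventually.of_forall fun n => Metric.mem_closedBall.1 (hu (φ n)))
  obtain ⟨n, hn⟩ := (hg₀.eventually (Metric.ball_mem_nhds g₀ hδ)).exists
  exact hgn (φ n) (Metric.mem_thickening_iff.2 ⟨g₀, hmem, hn⟩)

/-- Thickenings of convex sets are convex, so semicontinuity passes from limiting gradients to their
hulls. Nonemptiness is needed because the distance to an empty set would be `0`. -/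
lemma lowerSemicontinuous_infDist_clarkeEpsSubdifferential (hd : 0 < d)
    (hf : ∀ w w', |f w - f w'| ≤ L * ‖w - w'‖) (ε : ℝ)
    (hne : ∀ w, (clarkeEpsSubdifferential N ε f w).Nonempty) :
    LowerSemicontinuous fun w => Metric.infDist 0 (clarkeEpsSubdifferential N ε f w) := by
  intro w y hy
  have hδ : 0 < Metric.infDist 0 (clarkeEpsSubdifferential N ε f w) - y := sub_pos.2 hy
  filter_upwards [eventually_limitingGradients_subset_thickening (N := N) hd hf ε w
    (half_pos hδ)] with w' hw'
  have hsub : clarkeEpsSubdifferential N ε f w' ⊆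
      Metric.thickening ((Metric.infDist 0 (clarkeEpsSubdifferential N ε f w) - y) / 2)
        (clarkeEpsSubdifferential N ε f w) := by
    rw [clarkeEpsSubdifferential_eq_convexHull ε w']
    refine convexHull_min (hw'.trans (Metric.thickening_subset_of_subset _ ?_)) ?_
    · rw [clarkeEpsSubdifferential_eq_convexHull]
      exact subset_convexHull ℝ _
    · exact (convex_convexHull ℝ _).thickening _
  refine lt_of_lt_of_le (b := (Metric.infDist 0 (clarkeEpsSubdifferential N ε f w) + y) / 2)
    (by linarith) ((Metric.le_infDist (hne w')).2 fun g hg => ?_)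
  obtain ⟨g', hg', hgg'⟩ := Metric.mem_thickening_iff.1 (hsub hg)
  have h1 := Metric.infDist_le_dist_of_mem (x := 0) hg'
  have h2 := dist_triangle 0 g g'
  linarith

variable {τ : Measure (EuclideanSpace ℝ (Fin d))}

lemma ae_gradient_mem_clarkeEpsSubdifferential
    (hf : ∀ w w', |f w - f w'| ≤ L * ‖w - w'‖) (hN : volume N = 0) {ε : ℝ}
    (hτ : τ ≪ volume) (hτε : ∀ᵐ z ∂τ, ‖z‖ ≤ ε) (w : EuclideanSpace ℝ (Fin d)) :
    ∀ᵐ z ∂τ, gradient f (w + z) ∈ clarkeEpsSubdifferential N ε f w := by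
  have h1 : ∀ᵐ u ∂(volume : Measure (EuclideanSpace ℝ (Fin d))), u ∉ N :=
    measure_eq_zero_iff_ae_notMem.1 hN
  have h2 := (lipschitzWith_toNNReal_of_abs_sub_le hf).ae_differentiableAt
    (μ := (volume : Measure (EuclideanSpace ℝ (Fin d))))
  filter_upwards [ae_shift hτ (h1.and h2) w, hτε] with z hz hzε
  exact gradient_mem_clarkeEpsSubdifferential (by simpa using hzε) hz.1 hz.2

lemma nonempty_clarkeEpsSubdifferential [IsProbabilityMeasure τ]
    (hf : ∀ w w', |f w - f w'| ≤ L * ‖w - w'‖) (hN : volume N = 0) {ε : ℝ}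
    (hτ : τ ≪ volume) (hτε : ∀ᵐ z ∂τ, ‖z‖ ≤ ε) (w : EuclideanSpace ℝ (Fin d)) :
    (clarkeEpsSubdifferential N ε f w).Nonempty :=
  let ⟨_, hz⟩ := (ae_gradient_mem_clarkeEpsSubdifferential hf hN hτ hτε w).exists
  ⟨_, hz⟩

lemma measurable_gradient_euclidean : Measurable (gradient f) :=
  (InnerProductSpace.toDual ℝ (EuclideanSpace ℝ (Fin d))).symm.continuous.measurable.comp
    (measurable_fderiv ℝ f)

lemma integrable_gradient_shift [IsProbabilityMeasure τ] (hd : 0 < d) (hf : ∀ w w', |f w - f w'| ≤ L * ‖w - w'‖)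
    (w : EuclideanSpace ℝ (Fin d)) : Integrable (fun z => gradient f (w + z)) τ :=
  Integrable.of_bound
    (measurable_gradient_euclidean.comp (measurable_const_add w)).aestronglyMeasurable L
    (Eventually.of_forall fun _ => norm_gradient_le_of_abs_sub_le hd hf _)

/-- The mean of a random point of a convex set lies in its closure, and passing to the closure does
not change the distance. -/
lemma infDist_clarkeEpsSubdifferential_le [IsProbabilityMeasure τ] (hd : 0 < d)
    (hf : ∀ w w', |f w - f w'| ≤ L * ‖w - w'‖) (hN : volume N = 0) {ε : ℝ}
    (hτ : τ ≪ volume) (hτε : ∀ᵐ z ∂τ, ‖z‖ ≤ ε) (w : EuclideanSpace ℝ (Fin d)) :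
    Metric.infDist 0 (clarkeEpsSubdifferential N ε f w) ≤ ‖∫ z, gradient f (w + z) ∂τ‖ := by
  rw [← Metric.infDist_closure, ← dist_zero_left]
  refine Metric.infDist_le_dist_of_mem (Convex.integral_mem (convex_convexHull ℝ _).closure
    isClosed_closure ?_ (integrable_gradient_shift hd hf w))
  filter_upwards [ae_gradient_mem_clarkeEpsSubdifferential hf hN hτ hτε w] with z hz
  exact subset_closure hz
end

/-! ### Descent lemma and minibatch SGD with independent samples. -/

section
variable {V : Type*} [NormedAddCommGroup V] [InnerProductSpace ℝ V] [CompleteSpace V]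

lemma le_add_inner_add_of_lipschitz_gradient {φ : V → ℝ} {g : V → V} {M : ℝ}
    (hg : ∀ y, HasGradientAt φ (g y) y) (hM : ∀ x y, ‖g x - g y‖ ≤ M * ‖x - y‖) (x v : V) :
    φ (x + v) ≤ φ x + inner ℝ (g x) v + M / 2 * ‖v‖ ^ 2 := by
  -- The Lipschitz bound gives `ψ' ≤ 0` on `(0, 1)`, and `ψ 1 ≤ ψ 0` is the claim.
  let ψ : ℝ → ℝ := fun t => φ (x + t • v) - t * inner ℝ (g x) v - M / 2 * ‖v‖ ^ 2 * t ^ 2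
  have hψ : ∀ t, HasDerivAt ψ
      (inner ℝ (g (x + t • v)) v - inner ℝ (g x) v - M / 2 * ‖v‖ ^ 2 * (2 * t)) t := by
    intro t
    have h1 : HasDerivAt (fun t : ℝ => x + t • v) v t := by
      simpa using ((hasDerivAt_id t).smul_const v).const_add x
    have h2 := (hg (x + t • v)).hasFDerivAt.comp_hasDerivAt t h1
    have h3 := (h2.sub ((hasDerivAt_id t).mul_const (inner ℝ (g x) v))).sub
      ((hasDerivAt_pow 2 t).const_mul (M / 2 * ‖v‖ ^ 2))
    exact h3.congr_deriv (by simp)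
  have hanti : AntitoneOn ψ (Set.Icc 0 1) := by
    refine antitoneOn_of_deriv_nonpos (convex_Icc 0 1)
      (fun t _ => (hψ t).continuousAt.continuousWithinAt)
      (fun t _ => (hψ t).differentiableAt.differentiableWithinAt) fun t ht => ?_
    rw [interior_Icc] at ht
    rw [(hψ t).deriv, ← inner_sub_left]
    have h1 := real_inner_le_norm (g (x + t • v) - g x) v
    have h2 := hM (x + t • v) x
    rw [add_sub_cancel_left, norm_smul, Real.norm_of_nonneg ht.1.le] at h2
    nlinarith [mul_le_mul_of_nonneg_right h2 (norm_nonneg v)]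
  have h := hanti (Set.left_mem_Icc.2 zero_le_one) (Set.right_mem_Icc.2 zero_le_one) zero_le_one
  simp only [ψ, one_smul, zero_smul, add_zero, one_mul, zero_mul, sub_zero, one_pow, mul_one,
    ne_eq, OfNat.ofNat_ne_zero, not_false_eq_true, zero_pow, mul_zero] at h
  linarith

variable [MeasurableSpace V] [BorelSpace V] [SecondCountableTopology V]
variable {T : Type*} [MeasurableSpace T] {P : Measure T} [IsProbabilityMeasure P]
  {S : ℕ}

set_option linter.unusedSectionVars false

section moments
variable {X : T → V} {c : T → ℝ}

lemma memLp_two_of_norm_le (hX : Measurable X) (hc : MemLp c 2 P) (hXc : ∀ᵐ p ∂P, ‖X p‖ ≤ c p) :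
    MemLp X 2 P :=
  hc.mono hX.aestronglyMeasurable (hXc.mono fun _ hp => hp.trans (le_abs_self _))

lemma memLp_two_pi_eval (hX : MemLp X 2 P) (l : Fin S) :
    MemLp (fun q : Fin S → T => X (q l)) 2 (Measure.pi fun _ => P) :=
  hX.comp_measurePreserving (measurePreserving_eval (fun _ : Fin S => P) l)

lemma integral_inner_pi_eval_of_ne (hX : MemLp X 2 P) {l m : Fin S} (hlm : l ≠ m) :
    ∫ q : Fin S → T, inner ℝ (X (q l)) (X (q m)) ∂(Measure.pi fun _ => P) = ‖∫ p, X p ∂P‖ ^ 2 := by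
  have hind : iIndepFun (fun (i : Fin S) (q : Fin S → T) => q i) (Measure.pi fun _ => P) :=
    iIndepFun_pi (μ := fun _ : Fin S => P) (X := fun _ p => p) fun _ => aemeasurable_id
  have hpair := (hind.indepFun hlm)
  have hmap := (indepFun_iff_map_prod_eq_prod_map_map (measurable_pi_apply l).aemeasurable
    (measurable_pi_apply m).aemeasurable).1 hpair
  rw [(measurePreserving_eval (fun _ : Fin S => P) l).map_eq,
    (measurePreserving_eval (fun _ : Fin S => P) m).map_eq] at hmap
  have hXi : Integrable X P := hX.integrable one_le_two
  have hint : Integrable (fun r : T × T => (inner ℝ (X r.1) (X r.2) : ℝ)) (P.prod P) := by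
    refine Integrable.mono (hXi.norm.mul_prod hXi.norm) (hX.1.comp_fst.inner hX.1.comp_snd)
      (Eventually.of_forall fun r => ?_)
    simpa using norm_inner_le_norm (𝕜 := ℝ) (X r.1) (X r.2)
  have e : ∫ q : Fin S → T, inner ℝ (X (q l)) (X (q m)) ∂(Measure.pi fun _ => P) =
      ∫ r : T × T, inner ℝ (X r.1) (X r.2) ∂(P.prod P) := by
    rw [← hmap, integral_map ((measurable_pi_apply l).prodMk (measurable_pi_apply m)).aemeasurable]
    rw [hmap]; exact hint.1
  rw [e, integral_prod _ hint]
  simp_rw [integral_inner hXi]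
  simp_rw [real_inner_comm (∫ p, X p ∂P)]
  rw [integral_inner hXi, real_inner_self_eq_norm_sq]

lemma integrable_inner_pi_eval (hX : MemLp X 2 P) (l m : Fin S) :
    Integrable (fun q : Fin S → T => (inner ℝ (X (q l)) (X (q m)) : ℝ))
      (Measure.pi fun _ => P) := by
  have h1 := memLp_two_pi_eval hX l
  have h2 := memLp_two_pi_eval hX m
  refine Integrable.mono (h1.norm.integrable_mul h2.norm) (h1.1.inner h2.1)
    (Eventually.of_forall fun r => ?_)
  simpa using norm_inner_le_norm (𝕜 := ℝ) (X (r l)) (X (r m))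

lemma norm_sum_sq_eq (q : Fin S → T) :
    ‖∑ l, X (q l)‖ ^ 2 = ∑ l, ∑ m, inner ℝ (X (q l)) (X (q m)) := by
  rw [← real_inner_self_eq_norm_sq, sum_inner]
  simp_rw [inner_sum]

lemma integrable_norm_sum_sq (hX : MemLp X 2 P) :
    Integrable (fun q : Fin S → T => ‖∑ l, X (q l)‖ ^ 2) (Measure.pi fun _ => P) := by
  simp_rw [norm_sum_sq_eq]
  exact integrable_finsetSum _ fun l _ => integrable_finsetSum _ fun m _ =>
    integrable_inner_pi_eval hX l m

/-- Off-diagonal pairs are independent and each contributes the squared norm of the mean; diagonal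
terms are bounded by the second moment of `c`, with a spare squared mean added to complete `S²`
terms. -/
lemma integral_norm_sum_sq_le (hX : Measurable X) (hc : MemLp c 2 P)
    (hXc : ∀ᵐ p ∂P, ‖X p‖ ≤ c p) :
    ∫ q : Fin S → T, ‖∑ l, X (q l)‖ ^ 2 ∂(Measure.pi fun _ => P) ≤
      S * (∫ p, c p ^ 2 ∂P) + (S : ℝ) ^ 2 * ‖∫ p, X p ∂P‖ ^ 2 := by
  have hXL := memLp_two_of_norm_le hX hc hXc
  simp_rw [norm_sum_sq_eq]
  rw [integral_finsetSum _ fun l _ => integrable_finsetSum _ fun m _ =>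
    integrable_inner_pi_eval hXL l m]
  simp_rw [integral_finsetSum _ fun m _ => integrable_inner_pi_eval hXL _ m]
  calc _ ≤ ∑ l : Fin S, ∑ m : Fin S,
        ((if l = m then ∫ p, c p ^ 2 ∂P else 0) + ‖∫ p, X p ∂P‖ ^ 2) := by
        refine Finset.sum_le_sum fun l _ => Finset.sum_le_sum fun m _ => ?_
        split_ifs with h
        · subst h
          have e : ∫ q : Fin S → T, inner ℝ (X (q l)) (X (q l)) ∂(Measure.pi fun _ => P) =
              ∫ p, ‖X p‖ ^ 2 ∂P := by
            simp_rw [real_inner_self_eq_norm_sq]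
            exact integral_comp_eval (μ := fun _ : Fin S => P) (i := l)
              (f := fun p => ‖X p‖ ^ 2) (hX.norm.pow_const 2).aestronglyMeasurable
          rw [e]
          refine le_add_of_le_of_nonneg (integral_mono_ae hXL.integrable_norm_pow'
            hc.integrable_sq ?_) (sq_nonneg _)
          filter_upwards [hXc] with p hp
          exact pow_le_pow_left₀ (norm_nonneg _) hp 2
        · rw [integral_inner_pi_eval_of_ne hXL h, zero_add]
    _ = _ := by
        simp [Finset.sum_add_distrib]
        ring

end moments

/-- One step of stochastic gradient descent with a minibatch. -/
def sgdStep (H : V → T → V) (η : ℝ) (y : V) (q : Fin S → T) : V :=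
  y - (η / S) • ∑ l, H y (q l)

/-- The iterates of minibatch stochastic gradient descent; the minibatch `q (n + 1)` is used to pass
from the `n`-th to the `n + 1`-st iterate. -/
def sgdIterate (H : V → T → V) (η : ℝ) (x₁ : V) (q : ℕ → Fin S → T) : ℕ → V
  | 0 => x₁
  | n + 1 => sgdStep H η (sgdIterate H η x₁ q n) (q (n + 1))

lemma measurable_sgdStep {H : V → T → V} (hH : Measurable (Function.uncurry H)) (η : ℝ) :
    Measurable fun r : V × (Fin S → T) => sgdStep H η r.1 r.2 := by
  unfold sgdStep
  refine measurable_fst.sub (Measurable.const_smul ?_ _)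
  refine Finset.measurable_sum _ fun l _ => ?_
  exact hH.comp (measurable_fst.prodMk ((measurable_pi_apply l).comp measurable_snd))

lemma measurable_sgdIterate {H : V → T → V} (hH : Measurable (Function.uncurry H)) (η : ℝ) (x₁ : V)
    {A : Type*} [MeasurableSpace A] {Q : A → ℕ → Fin S → T} (hQ : ∀ n l, Measurable fun a => Q a n l)
    (n : ℕ) : Measurable fun a => sgdIterate H η x₁ (Q a) n := by
  induction n with
  | zero => exact measurable_const
  | succ n ih =>
    exact (measurable_sgdStep hH η).comp (ih.prodMk (measurable_pi_lambda _ fun l => hQ (n + 1) l))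

lemma sgdIterate_congr (H : V → T → V) (η : ℝ) (x₁ : V) {q q' : ℕ → Fin S → T} (n : ℕ)
    (h : ∀ k, 1 ≤ k → k ≤ n → q k = q' k) :
    sgdIterate H η x₁ q n = sgdIterate H η x₁ q' n := by
  induction n with
  | zero => rfl
  | succ n ih =>
    rw [sgdIterate, sgdIterate, ih fun k h1 h2 => h k h1 (by omega), h (n + 1) (by omega) le_rfl]

/-- Expected decrease in one step. -/
lemma lintegral_sgdStep_le {φ : V → ℝ} {g : V → V} {H : V → T → V} {c : T → ℝ} {M η m₀ : ℝ}
    (hS : 0 < S) (hη : 0 < η) (hMη : M * η = 1)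
    (hg : ∀ y, HasGradientAt φ (g y) y) (hM : ∀ x y, ‖g x - g y‖ ≤ M * ‖x - y‖)
    (hm₀ : ∀ y, m₀ ≤ φ y) (hH : Measurable (Function.uncurry H)) (hc : MemLp c 2 P)
    (hHc : ∀ y, ∀ᵐ p ∂P, ‖H y p‖ ≤ c p) (hHg : ∀ y, ∫ p, H y p ∂P = g y) (y : V) :
    ∫⁻ q, ENNReal.ofReal (φ (sgdStep H η y q) - m₀) ∂(Measure.pi fun _ : Fin S => P) +
        ENNReal.ofReal (η / 2 * ‖g y‖ ^ 2) ≤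
      ENNReal.ofReal (φ y - m₀) + ENNReal.ofReal (η / 2 * ((∫ p, c p ^ 2 ∂P) / S)) := by
  have hS' : (0 : ℝ) < S := by exact_mod_cast hS
  have hHy : Measurable (H y) := hH.comp measurable_prodMk_left
  have hL := memLp_two_of_norm_le hHy hc (hHc y)
  have hφ : Measurable φ := (continuous_iff_continuousAt.2 fun y =>
    (hg y).differentiableAt.continuousAt).measurable
  let D : (Fin S → T) → V := fun q => ∑ l, H y (q l)
  let U : (Fin S → T) → ℝ := fun q =>
    φ y - η / S * inner ℝ (g y) (D q) + M / 2 * (η / S) ^ 2 * ‖D q‖ ^ 2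
  have hle : ∀ q, φ (sgdStep H η y q) ≤ U q := by
    intro q
    have h := le_add_inner_add_of_lipschitz_gradient hg hM y (-((η / S) • D q))
    rw [← sub_eq_add_neg, inner_neg_right, inner_smul_right, norm_neg, norm_smul, mul_pow,
      Real.norm_eq_abs, sq_abs] at h
    refine h.trans_eq ?_
    simp only [U]; ring
  have hevi : ∀ l : Fin S, Integrable (fun q : Fin S → T => H y (q l)) (Measure.pi fun _ => P) :=
    fun l => (memLp_two_pi_eval hL l).integrable one_le_two
  have hDi : Integrable D (Measure.pi fun _ => P) := integrable_finsetSum _ fun l _ => hevi l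
  have hDint : ∫ q, D q ∂(Measure.pi fun _ : Fin S => P) = (S : ℝ) • g y := by
    rw [integral_finsetSum _ fun l _ => hevi l]
    have : ∀ l : Fin S, ∫ q : Fin S → T, H y (q l) ∂(Measure.pi fun _ => P) = g y := fun l =>
      (integral_comp_eval (μ := fun _ : Fin S => P) (i := l) (f := H y)
        hHy.aestronglyMeasurable).trans (hHg y)
    simp [this, Nat.cast_smul_eq_nsmul]
  have hD2 : Integrable (fun q => ‖D q‖ ^ 2) (Measure.pi fun _ : Fin S => P) :=
    integrable_norm_sum_sq hL
  have hI1 : Integrable (fun q => φ y - η / S * inner ℝ (g y) (D q))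
      (Measure.pi fun _ : Fin S => P) :=
    (integrable_const _).sub ((hDi.const_inner (g y)).const_mul _)
  have hUi : Integrable U (Measure.pi fun _ : Fin S => P) := hI1.add (hD2.const_mul _)
  have hUint : ∫ q, U q ∂(Measure.pi fun _ : Fin S => P) ≤
      φ y - η / 2 * ‖g y‖ ^ 2 + η / 2 * ((∫ p, c p ^ 2 ∂P) / S) := by
    have h2 := integral_norm_sum_sq_le (S := S) hHy hc (hHc y)
    rw [hHg y] at h2
    have hM0 : 0 < M := by
      by_contra h
      nlinarith
    calc _ = φ y - η / S * (S * ‖g y‖ ^ 2) + M / 2 * (η / S) ^ 2 *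
          ∫ q, ‖D q‖ ^ 2 ∂(Measure.pi fun _ : Fin S => P) := by
          rw [integral_add hI1 (hD2.const_mul _), integral_sub (integrable_const _)
            ((hDi.const_inner (g y)).const_mul _), integral_const_mul, integral_const_mul,
            integral_inner hDi, hDint, inner_smul_right, real_inner_self_eq_norm_sq]
          simp
      _ ≤ φ y - η / S * (S * ‖g y‖ ^ 2) + M / 2 * (η / S) ^ 2 *
          (S * (∫ p, c p ^ 2 ∂P) + (S : ℝ) ^ 2 * ‖g y‖ ^ 2) := by gcongr
      -- With `M * η = 1` the quadratic term gives back exactly half of the first-order decrease.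
      _ = φ y - η * ‖g y‖ ^ 2 + (M * η) * η / 2 * ((∫ p, c p ^ 2 ∂P) / S + ‖g y‖ ^ 2) := by
          field_simp
      _ = _ := by rw [hMη]; ring
  have hmeas : Measurable fun q : Fin S → T => φ (sgdStep H η y q) :=
    hφ.comp ((measurable_sgdStep hH η).comp measurable_prodMk_left)
  have hφi : Integrable (fun q => φ (sgdStep H η y q)) (Measure.pi fun _ : Fin S => P) :=
    integrable_of_le_of_le hmeas.aestronglyMeasurable
      (Eventually.of_forall fun q => hm₀ _) (Eventually.of_forall hle) (integrable_const m₀) hUi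
  -- Since `φ - m₀ ≥ 0`, the inequality lives in `ENNReal`, and iterating it needs no integrability
  -- of `φ` along the iterates.
  rw [← ofReal_integral_eq_lintegral_ofReal (f := fun q => φ (sgdStep H η y q) - m₀)
    (hφi.sub (integrable_const _))
    (Eventually.of_forall fun q => sub_nonneg.2 (hm₀ _)),
    integral_sub hφi (integrable_const _), integral_const, probReal_univ, one_smul]
  have hint := (integral_mono hφi hUi hle).trans hUint
  have hlow : m₀ ≤ ∫ q, φ (sgdStep H η y q) ∂(Measure.pi fun _ : Fin S => P) := by
    simpa using integral_mono (integrable_const m₀) hφi fun q => hm₀ (sgdStep H η y q)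
  have hQ : 0 ≤ ∫ p, c p ^ 2 ∂P := integral_nonneg fun p => sq_nonneg _
  rw [← ENNReal.ofReal_add (sub_nonneg.2 hlow) (by positivity),
    ← ENNReal.ofReal_add (sub_nonneg.2 (hm₀ y)) (by positivity)]
  exact ENNReal.ofReal_le_ofReal (by linarith)
end

section
set_option linter.unusedSectionVars false

variable {V : Type*} [NormedAddCommGroup V] [InnerProductSpace ℝ V] [CompleteSpace V]
  [MeasurableSpace V] [BorelSpace V] [SecondCountableTopology V]
  {T : Type*} [MeasurableSpace T] {S : ℕ}

/-- The `n`-th iterate is a measurable function of the samples with index at most `n`. -/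
lemma exists_measurable_sgdIterate_eq [Nonempty T] {H : V → T → V}
    (hH : Measurable (Function.uncurry H)) (η : ℝ) (x₁ : V) {K n : ℕ} (hn : n < K)
    (A : Finset (Set.Ico 1 K × Fin S)) (hA : ∀ i : Set.Ico 1 K × Fin S, (i.1 : ℕ) ≤ n → i ∈ A) :
    ∃ ψ : (A → T) → V, Measurable ψ ∧
      ∀ q : ℕ → Fin S → T, sgdIterate H η x₁ q n = ψ fun i => q i.1.1 i.1.2 := by
  classical
  obtain ⟨t₀⟩ := ‹Nonempty T›
  -- The filler `t₀` is never read: the `n`-th iterate uses only indices `1, …, n`.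
  let Q : (A → T) → ℕ → Fin S → T := fun u k l =>
    if h : ∃ hk : k ∈ Set.Ico 1 K, ((⟨k, hk⟩, l) : Set.Ico 1 K × Fin S) ∈ A then
      u ⟨(⟨k, h.1⟩, l), h.2⟩ else t₀
  refine ⟨fun u => sgdIterate H η x₁ (Q u) n, measurable_sgdIterate hH η x₁ ?_ n, ?_⟩
  · intro k l
    by_cases h : ∃ hk : k ∈ Set.Ico 1 K, ((⟨k, hk⟩, l) : Set.Ico 1 K × Fin S) ∈ A
    · simp only [Q, dif_pos h]
      exact measurable_pi_apply _
    · simp only [Q, dif_neg h]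
      exact measurable_const
  · intro q
    refine sgdIterate_congr H η x₁ n fun k h1 h2 => ?_
    funext l
    have hk : k ∈ Set.Ico 1 K := ⟨h1, h2.trans_lt hn⟩
    have h : ∃ hk : k ∈ Set.Ico 1 K, ((⟨k, hk⟩, l) : Set.Ico 1 K × Fin S) ∈ A := ⟨hk, hA _ h2⟩
    simp only [Q, dif_pos h]

variable {Ω : Type*} [MeasurableSpace Ω] {μ : Measure Ω} [IsProbabilityMeasure μ]
  {P : Measure T} [IsProbabilityMeasure P] {K : ℕ} {q : ℕ → Fin S → Ω → T}
  {H : V → T → V} {η : ℝ} {x₁ : V}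

/-- The iterate depends on samples of index at most `n`, a block disjoint from that of index `n +
1`. -/
lemma indepFun_sgdIterate_minibatch (hH : Measurable (Function.uncurry H)) (η : ℝ) (x₁ : V)
    (hq : ∀ k l, Measurable (q k l))
    (hind : iIndepFun (fun (i : Set.Ico 1 K × Fin S) ω => q i.1 i.2 ω) μ)
    {n : ℕ} (hn : n + 1 < K) :
    IndepFun (fun ω => sgdIterate H η x₁ (fun k l => q k l ω) n) (fun ω l => q (n + 1) l ω) μ := by
  classical
  have : Nonempty Ω := nonempty_of_isProbabilityMeasure μ
  rcases isEmpty_or_nonempty T with hT | hT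
  · rcases S.eq_zero_or_pos with rfl | hS
    · have : (fun ω (l : Fin 0) => q (n + 1) l ω) = fun _ l => l.elim0 := by
        funext ω l; exact l.elim0
      rw [this]
      exact indepFun_const_right _ _
    · exact (hT.false (q 0 ⟨0, hS⟩ (Classical.arbitrary Ω))).elim
  let A : Finset (Set.Ico 1 K × Fin S) := Finset.univ.filter fun i => (i.1 : ℕ) ≤ n
  let B : Finset (Set.Ico 1 K × Fin S) := Finset.univ.filter fun i => (i.1 : ℕ) = n + 1
  have hAB : Disjoint A B := by
    refine Finset.disjoint_filter.2 fun i _ h1 h2 => ?_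
    omega
  obtain ⟨ψ, hψ, hψq⟩ := exists_measurable_sgdIterate_eq (T := T) hH η x₁
    (Nat.lt_of_succ_lt hn) A fun i hi => by simpa [A] using hi
  have h := hind.indepFun_finset A B hAB fun i => hq _ _
  let χ : (B → T) → Fin S → T := fun u l =>
    u ⟨(⟨n + 1, Set.mem_Ico.2 ⟨by omega, hn⟩⟩, l), by simp [B]⟩
  have hχ : Measurable χ := measurable_pi_lambda _ fun l => measurable_pi_apply _
  have h' := h.comp hψ hχ
  have e : (fun ω => sgdIterate H η x₁ (fun k l => q k l ω) n) =
      ψ ∘ fun ω (i : A) => q i.1.1 i.1.2 ω := funext fun ω => hψq fun k l => q k l ω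
  rw [e]
  exact h'

lemma map_minibatch_eq_pi (hq : ∀ k l, Measurable (q k l))
    (hlaw : ∀ k ∈ Set.Ico 1 K, ∀ l, μ.map (q k l) = P)
    (hind : iIndepFun (fun (i : Set.Ico 1 K × Fin S) ω => q i.1 i.2 ω) μ)
    {k : ℕ} (hk : k ∈ Set.Ico 1 K) :
    μ.map (fun ω l => q k l ω) = Measure.pi fun _ : Fin S => P := by
  have h : iIndepFun (fun l => q k l) μ :=
    hind.precomp (g := fun l : Fin S => ((⟨k, hk⟩, l) : Set.Ico 1 K × Fin S))
      fun l m hlm => (Prod.mk.inj hlm).2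
  rw [(iIndepFun_iff_map_fun_eq_pi_map fun l => (hq k l).aemeasurable).1 h]
  congr 1
  funext l
  exact hlaw k hk l

variable {φ : V → ℝ} {g : V → V} {c : T → ℝ} {M m₀ : ℝ}

lemma lintegral_sgdIterate_add_sum_le (hS : 0 < S) (hη : 0 < η) (hMη : M * η = 1)
    (hg : ∀ y, HasGradientAt φ (g y) y) (hM : ∀ x y, ‖g x - g y‖ ≤ M * ‖x - y‖)
    (hgm : Measurable g)
    (hm₀ : ∀ y, m₀ ≤ φ y) (hH : Measurable (Function.uncurry H)) (hc : MemLp c 2 P)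
    (hHc : ∀ y, ∀ᵐ p ∂P, ‖H y p‖ ≤ c p) (hHg : ∀ y, ∫ p, H y p ∂P = g y)
    (hq : ∀ k l, Measurable (q k l)) (hlaw : ∀ k ∈ Set.Ico 1 K, ∀ l, μ.map (q k l) = P)
    (hind : iIndepFun (fun (i : Set.Ico 1 K × Fin S) ω => q i.1 i.2 ω) μ) {n : ℕ} (hn : n < K) :
    ∫⁻ ω, ENNReal.ofReal (φ (sgdIterate H η x₁ (fun k l => q k l ω) n) - m₀) ∂μ +
      ∑ k ∈ Finset.range n,
        ∫⁻ ω, ENNReal.ofReal (η / 2 * ‖g (sgdIterate H η x₁ (fun k l => q k l ω) k)‖ ^ 2) ∂μ ≤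
      ENNReal.ofReal (φ x₁ - m₀) + n * ENNReal.ofReal (η / 2 * ((∫ p, c p ^ 2 ∂P) / S)) := by
  have hφ : Measurable φ := (continuous_iff_continuousAt.2 fun y =>
    (hg y).differentiableAt.continuousAt).measurable
  have hYm : ∀ n, Measurable fun ω => sgdIterate H η x₁ (fun k l => q k l ω) n :=
    measurable_sgdIterate hH η x₁ hq
  have ha : Measurable fun y => ENNReal.ofReal (φ y - m₀) := (hφ.sub_const _).ennreal_ofReal
  induction n with
  | zero => simp [sgdIterate]
  | succ n ih =>
    -- Independence makes the joint law of iterate and next minibatch a product, so the iterate can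
    -- be frozen while integrating over the minibatch.
    have hstep : ∫⁻ ω, ENNReal.ofReal
          (φ (sgdIterate H η x₁ (fun k l => q k l ω) (n + 1)) - m₀) ∂μ =
        ∫⁻ ω, (∫⁻ p, ENNReal.ofReal (φ (sgdStep H η
          (sgdIterate H η x₁ (fun k l => q k l ω) n) p) - m₀)
            ∂(Measure.pi fun _ : Fin S => P)) ∂μ := by
      have hind' := indepFun_sgdIterate_minibatch hH η x₁ hq hind hn
      have hpm : Measurable fun ω l => q (n + 1) l ω := measurable_pi_lambda _ (hq (n + 1))
      have hmap := (indepFun_iff_map_prod_eq_prod_map_map (hYm n).aemeasurable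
        hpm.aemeasurable).1 hind'
      rw [map_minibatch_eq_pi hq hlaw hind ⟨by omega, hn⟩] at hmap
      have hm : Measurable fun r : V × (Fin S → T) => ENNReal.ofReal (φ (sgdStep H η r.1 r.2) - m₀) :=
        ha.comp (measurable_sgdStep hH η)
      calc _ = ∫⁻ r, ENNReal.ofReal (φ (sgdStep H η r.1 r.2) - m₀) ∂(μ.map fun ω =>
            (sgdIterate H η x₁ (fun k l => q k l ω) n, fun l => q (n + 1) l ω)) := by
            rw [lintegral_map hm ((hYm n).prodMk hpm)]
            rfl
        _ = _ := by
            rw [hmap, lintegral_prod _ hm.aemeasurable, lintegral_map hm.lintegral_prod_right' (hYm n)]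
    have hb : Measurable fun y => ENNReal.ofReal (η / 2 * ‖g y‖ ^ 2) :=
      ((hgm.norm.pow_const 2).const_mul _).ennreal_ofReal
    have hbY : Measurable fun ω =>
        ENNReal.ofReal (η / 2 * ‖g (sgdIterate H η x₁ (fun k l => q k l ω) n)‖ ^ 2) :=
      hb.comp (hYm n)
    have hone : ∫⁻ ω, ENNReal.ofReal
          (φ (sgdIterate H η x₁ (fun k l => q k l ω) (n + 1)) - m₀) ∂μ +
        ∫⁻ ω, ENNReal.ofReal (η / 2 * ‖g (sgdIterate H η x₁ (fun k l => q k l ω) n)‖ ^ 2) ∂μ ≤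
        ∫⁻ ω, ENNReal.ofReal (φ (sgdIterate H η x₁ (fun k l => q k l ω) n) - m₀) ∂μ +
          ENNReal.ofReal (η / 2 * ((∫ p, c p ^ 2 ∂P) / S)) := by
      rw [hstep, ← lintegral_add_right _ hbY]
      refine (lintegral_mono fun ω => lintegral_sgdStep_le hS hη hMη hg hM hm₀ hH hc hHc hHg _).trans
        (le_of_eq ?_)
      rw [lintegral_add_right _ measurable_const]
      simp
    rw [Finset.sum_range_succ, add_comm (∑ k ∈ Finset.range n, _), ← add_assoc]
    refine (add_le_add_left hone _).trans ?_
    rw [add_right_comm]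
    refine (add_le_add_left (ih (Nat.lt_of_succ_lt hn)) _).trans (le_of_eq ?_)
    push_cast
    ring

/-- The expected squared gradient norm at a uniformly drawn iterate. -/
lemma lintegral_norm_gradient_sgdIterate_le (hK : 0 < K) (hS : 0 < S) (hη : 0 < η)
    (hMη : M * η = 1)
    (hg : ∀ y, HasGradientAt φ (g y) y) (hM : ∀ x y, ‖g x - g y‖ ≤ M * ‖x - y‖)
    (hgm : Measurable g)
    (hm₀ : ∀ y, m₀ ≤ φ y) (hH : Measurable (Function.uncurry H)) (hc : MemLp c 2 P)
    (hHc : ∀ y, ∀ᵐ p ∂P, ‖H y p‖ ≤ c p) (hHg : ∀ y, ∫ p, H y p ∂P = g y)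
    (hq : ∀ k l, Measurable (q k l)) (hlaw : ∀ k ∈ Set.Ico 1 K, ∀ l, μ.map (q k l) = P)
    (hind : iIndepFun (fun (i : Set.Ico 1 K × Fin S) ω => q i.1 i.2 ω) μ)
    {R : Ω → ℕ} (hR : Measurable R) (hRlaw : μ.map R = uniformOn (Set.Icc 1 K))
    (hRind : IndepFun R (fun ω (i : Set.Ico 1 K × Fin S) => q i.1 i.2 ω) μ) :
    ∫⁻ ω, ENNReal.ofReal
        (η / 2 * ‖g (sgdIterate H η x₁ (fun k l => q k l ω) (R ω - 1))‖ ^ 2) ∂μ ≤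
      (K : ENNReal)⁻¹ * ENNReal.ofReal (φ x₁ - m₀ + K * (η / 2 * ((∫ p, c p ^ 2 ∂P) / S))) := by
  classical
  have hT : Nonempty T := nonempty_of_isProbabilityMeasure P
  have hYm : ∀ n, Measurable fun ω => sgdIterate H η x₁ (fun k l => q k l ω) n :=
    measurable_sgdIterate hH η x₁ hq
  have hb : Measurable fun y => ENNReal.ofReal (η / 2 * ‖g y‖ ^ 2) :=
    ((hgm.norm.pow_const 2).const_mul _).ennreal_ofReal
  have hQ : 0 ≤ ∫ p, c p ^ 2 ∂P := integral_nonneg fun p => sq_nonneg _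
  have hsum : ∑ k ∈ Finset.range K,
      ∫⁻ ω, ENNReal.ofReal (η / 2 * ‖g (sgdIterate H η x₁ (fun k l => q k l ω) k)‖ ^ 2) ∂μ ≤
      ENNReal.ofReal (φ x₁ - m₀ + K * (η / 2 * ((∫ p, c p ^ 2 ∂P) / S))) := by
    obtain ⟨n, rfl⟩ : ∃ n, K = n + 1 := ⟨K - 1, by omega⟩
    have h1 := lintegral_sgdIterate_add_sum_le (x₁ := x₁) hS hη hMη hg hM hgm hm₀ hH hc hHc hHg hq
      hlaw hind (Nat.lt_succ_self n)
    -- Telescoping controls only the first `K - 1` gradients, since the run draws no `K`-th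
    -- minibatch. The last one is bounded by a fictitious extra step, integrated against the product
    -- law itself.
    have h2 : ∫⁻ ω, ENNReal.ofReal
          (η / 2 * ‖g (sgdIterate H η x₁ (fun k l => q k l ω) n)‖ ^ 2) ∂μ ≤
        ∫⁻ ω, ENNReal.ofReal (φ (sgdIterate H η x₁ (fun k l => q k l ω) n) - m₀) ∂μ +
          ENNReal.ofReal (η / 2 * ((∫ p, c p ^ 2 ∂P) / S)) := by
      refine (lintegral_mono fun ω => le_add_self.trans
        (lintegral_sgdStep_le hS hη hMη hg hM hm₀ hH hc hHc hHg _)).trans (le_of_eq ?_)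
      rw [lintegral_add_right _ measurable_const]
      simp
    rw [Finset.sum_range_succ, ENNReal.ofReal_add (sub_nonneg.2 (hm₀ _)) (by positivity),
      ENNReal.ofReal_mul (by positivity), ENNReal.ofReal_natCast]
    refine (add_le_add_right h2 _).trans ?_
    rw [← add_assoc, add_comm (∑ k ∈ Finset.range n, _)]
    refine (add_le_add_left h1 _).trans (le_of_eq ?_)
    push_cast
    ring
  have hRprob : ∀ k ∈ Finset.range K, μ (R ⁻¹' {k + 1}) = (K : ENNReal)⁻¹ := by
    intro k hk
    rw [← Measure.map_apply hR (measurableSet_singleton _), hRlaw, ← Finset.coe_Icc,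
      ← Finset.coe_singleton, uniformOn_apply_finset, Finset.inter_singleton_of_mem
        (Finset.mem_Icc.2 ⟨by omega, Finset.mem_range.1 hk⟩)]
    simp
  have hRmem : ∀ᵐ ω ∂μ, R ω ∈ Set.Icc 1 K := by
    have : ∀ᵐ k ∂(μ.map R), k ∈ Set.Icc 1 K := by
      rw [hRlaw, uniformOn]
      exact ae_cond_mem (Set.finite_Icc 1 K).measurableSet
    exact ae_of_ae_map hR.aemeasurable this
  have hRY : ∀ k, k < K → IndepFun R (fun ω => sgdIterate H η x₁ (fun k l => q k l ω) k) μ := by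
    intro k hk
    obtain ⟨ψ, hψ, hψq⟩ := exists_measurable_sgdIterate_eq (T := T) (S := S) hH η x₁ hk Finset.univ
      fun i _ => Finset.mem_univ i
    have h := hRind.comp measurable_id (hψ.comp
      (measurable_pi_lambda (fun (u : (Set.Ico 1 K × Fin S) → T)
        (i : (Finset.univ : Finset (Set.Ico 1 K × Fin S))) => u i.1)
          fun i => measurable_pi_apply i.1))
    have e : (fun ω => sgdIterate H η x₁ (fun k l => q k l ω) k) =
        ψ ∘ fun ω (i : (Finset.univ : Finset (Set.Ico 1 K × Fin S))) => q i.1.1 i.1.2 ω :=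
      funext fun ω => hψq fun k l => q k l ω
    rw [e]
    exact h
  -- Splitting along `R = k + 1`, an event of probability `1/K` independent of iterate `k`, turns
  -- the expectation into an average over iterates.
  calc _ = ∫⁻ ω, ∑ k ∈ Finset.range K, (R ⁻¹' {k + 1}).indicator (fun _ => 1) ω *
        ENNReal.ofReal (η / 2 * ‖g (sgdIterate H η x₁ (fun k l => q k l ω) k)‖ ^ 2) ∂μ := by
        refine lintegral_congr_ae ?_
        filter_upwards [hRmem] with ω hω
        obtain ⟨h1, h2⟩ := hω
        rw [Finset.sum_eq_single (R ω - 1)]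
        · rw [Set.indicator_of_mem (by simp; omega), one_mul]
        · intro k _ hk
          rw [Set.indicator_of_notMem (by simp; omega), zero_mul]
        · intro h
          exact absurd (Finset.mem_range.2 (by omega)) h
    _ = ∑ k ∈ Finset.range K, (K : ENNReal)⁻¹ *
        ∫⁻ ω, ENNReal.ofReal (η / 2 * ‖g (sgdIterate H η x₁ (fun k l => q k l ω) k)‖ ^ 2) ∂μ := by
        have hsm : ∀ k ∈ Finset.range K, Measurable fun ω =>
            (R ⁻¹' {k + 1}).indicator (fun _ => (1 : ENNReal)) ω *
              ENNReal.ofReal (η / 2 * ‖g (sgdIterate H η x₁ (fun k l => q k l ω) k)‖ ^ 2) :=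
          fun k _ => (measurable_const.indicator (hR (measurableSet_singleton _))).mul
            (hb.comp (hYm k))
        rw [lintegral_finsetSum _ hsm]
        have hind1 : ∀ k, Measurable (({k} : Set ℕ).indicator fun _ => (1 : ENNReal)) :=
          fun k => measurable_const.indicator (measurableSet_singleton k)
        refine Finset.sum_congr rfl fun k hk => ?_
        have hi := (hRY k (Finset.mem_range.1 hk)).comp
          (hind1 (k + 1)) hb
        have := lintegral_mul_eq_lintegral_mul_lintegral_of_indepFun
          ((hind1 (k + 1)).comp hR) (hb.comp (hYm k)) hi
        rw [← hRprob k hk]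
        refine Eq.trans ?_ (this.trans ?_)
        · rfl
        · congr 1
          change ∫⁻ ω, (R ⁻¹' {k + 1}).indicator (fun _ => 1) ω ∂μ = _
          rw [lintegral_indicator (hR (measurableSet_singleton _))]
          simp
    _ ≤ _ := by
        rw [← Finset.mul_sum]
        gcongr
end

lemma sq_integral_le_integral_sq {Ω : Type*} [MeasurableSpace Ω] {μ : Measure Ω}
    [IsProbabilityMeasure μ] {X : Ω → ℝ} (hX : MemLp X 2 μ) :
    (∫ ω, X ω ∂μ) ^ 2 ≤ ∫ ω, X ω ^ 2 ∂μ := by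
  have h := variance_nonneg X μ
  rw [variance_eq_sub hX] at h
  simpa using sub_nonneg.1 h

/-! ### Randomized smoothing over a ball. -/

section smoothing
variable {d : ℕ} {f : EuclideanSpace ℝ (Fin d) → ℝ} {L σ : ℝ}

/-- The uniform distribution on the closed ball of radius `σ`. -/
def uniformBall (d : ℕ) (σ : ℝ) : Measure (EuclideanSpace ℝ (Fin d)) :=
  ProbabilityTheory.cond volume (Metric.closedBall 0 σ)

lemma isProbabilityMeasure_uniformBall (hσ : 0 < σ) : IsProbabilityMeasure (uniformBall d σ) :=
  cond_isProbabilityMeasure_of_finite (Metric.measure_closedBall_pos volume 0 hσ).ne'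
    measure_closedBall_lt_top.ne

lemma uniformBall_absolutelyContinuous : uniformBall d σ ≪ volume :=
  cond_absolutelyContinuous

lemma ae_norm_le_uniformBall : ∀ᵐ z ∂(uniformBall d σ), ‖z‖ ≤ σ := by
  have := ae_cond_mem (μ := (volume : Measure (EuclideanSpace ℝ (Fin d))))
    (Metric.isClosed_closedBall (x := 0) (ε := σ)).measurableSet
  filter_upwards [this] with z hz using by simpa using hz

/-- The randomized smoothing of `f` over the ball of radius `σ`. -/
def ballSmoothing (σ : ℝ) (f : EuclideanSpace ℝ (Fin d) → ℝ) (y : EuclideanSpace ℝ (Fin d)) : ℝ :=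
  ∫ z, f (y + z) ∂(uniformBall d σ)

/-- The average of the gradient of `f` over the ball of radius `σ`. -/
def ballGradient (σ : ℝ) (f : EuclideanSpace ℝ (Fin d) → ℝ) (y : EuclideanSpace ℝ (Fin d)) :
    EuclideanSpace ℝ (Fin d) :=
  ∫ z, gradient f (y + z) ∂(uniformBall d σ)

lemma ballGradient_eq (y : EuclideanSpace ℝ (Fin d)) :
    ballGradient σ f y = (volume.real (Metric.closedBall (0 : EuclideanSpace ℝ (Fin d)) σ))⁻¹ •
      ∫ u in Metric.closedBall y σ, gradient f u := by
  have h := (measurePreserving_add_left volume y).setIntegral_preimage_emb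
    (measurableEmbedding_addLeft y) (gradient f) (Metric.closedBall y σ)
  have hpre : (fun z => y + z) ⁻¹' Metric.closedBall y σ = Metric.closedBall 0 σ := by
    ext z; simp
  rw [hpre] at h
  rw [ballGradient, uniformBall, ProbabilityTheory.cond, integral_smul_measure, h, measureReal_def,
    ENNReal.toReal_inv]

lemma norm_ballGradient_sub_le (hd : 0 < d) (hf : ∀ w w', |f w - f w'| ≤ L * ‖w - w'‖)
    (hσ : 0 < σ) (x y : EuclideanSpace ℝ (Fin d)) :
    ‖ballGradient σ f x - ballGradient σ f y‖ ≤ L * √d / σ * ‖x - y‖ := by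
  have hV := volume_real_closedBall_pos (0 : EuclideanSpace ℝ (Fin d)) hσ
  rw [ballGradient_eq, ballGradient_eq, ← smul_sub, norm_smul, norm_inv, Real.norm_of_nonneg hV.le,
    inv_mul_le_iff₀ hV]
  exact norm_setIntegral_closedBall_sub_le hd measurable_gradient_euclidean
    (norm_gradient_le_of_abs_sub_le hd hf) hσ x y

lemma measurable_ballGradient (hd : 0 < d) (hf : ∀ w w', |f w - f w'| ≤ L * ‖w - w'‖)
    (hσ : 0 < σ) : Measurable (ballGradient σ f) :=
  (LipschitzWith.of_dist_le_mul (K := (L * √d / σ).toNNReal) fun u v => by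
    rw [dist_eq_norm, dist_eq_norm]
    exact (norm_ballGradient_sub_le hd hf hσ u v).trans (mul_le_mul_of_nonneg_right
      (Real.le_coe_toNNReal _) (norm_nonneg _))).continuous.measurable

lemma norm_ballGradient_le (hd : 0 < d) (hf : ∀ w w', |f w - f w'| ≤ L * ‖w - w'‖)
    (hσ : 0 < σ) (y : EuclideanSpace ℝ (Fin d)) : ‖ballGradient σ f y‖ ≤ L := by
  have := isProbabilityMeasure_uniformBall (d := d) hσ
  have h := norm_integral_le_of_norm_le_const (μ := uniformBall d σ)
    (Eventually.of_forall fun z => norm_gradient_le_of_abs_sub_le hd hf (y + z))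
  simpa [ballGradient] using h

lemma integrable_shift_uniformBall (hf : ∀ w w', |f w - f w'| ≤ L * ‖w - w'‖)
    (hL : 0 ≤ L) (hσ : 0 < σ) (y : EuclideanSpace ℝ (Fin d)) :
    Integrable (fun z => f (y + z)) (uniformBall d σ) := by
  have := isProbabilityMeasure_uniformBall (d := d) hσ
  have hc : Continuous f := (lipschitzWith_toNNReal_of_abs_sub_le hf).continuous
  refine Integrable.of_bound (hc.comp (continuous_const_add y)).aestronglyMeasurable
    (|f y| + L * σ) ?_
  filter_upwards [ae_norm_le_uniformBall] with z hz
  have h1 := hf (y + z) y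
  rw [add_sub_cancel_left] at h1
  have h2 := abs_sub_abs_le_abs_sub (f (y + z)) (f y)
  rw [Real.norm_eq_abs]
  nlinarith

lemma le_ballSmoothing (hf : ∀ w w', |f w - f w'| ≤ L * ‖w - w'‖) (hL : 0 ≤ L) (hσ : 0 < σ)
    {m : ℝ} (hm : ∀ w, m ≤ f w) (y : EuclideanSpace ℝ (Fin d)) : m ≤ ballSmoothing σ f y := by
  have := isProbabilityMeasure_uniformBall (d := d) hσ
  simpa [ballSmoothing] using integral_mono (integrable_const m)
    (integrable_shift_uniformBall hf hL hσ y) fun z => hm (y + z)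

/-- The price of starting from the smoothed objective; it becomes the `L₀² √d K^(-β)` term of the
final bound. -/
lemma ballSmoothing_le (hf : ∀ w w', |f w - f w'| ≤ L * ‖w - w'‖) (hL : 0 ≤ L) (hσ : 0 < σ)
    (y : EuclideanSpace ℝ (Fin d)) : ballSmoothing σ f y ≤ f y + L * σ := by
  have := isProbabilityMeasure_uniformBall (d := d) hσ
  have h : ∫ z, f (y + z) ∂(uniformBall d σ) ≤ ∫ _, (f y + L * σ) ∂(uniformBall d σ) := by
    refine integral_mono_ae (integrable_shift_uniformBall hf hL hσ y) (integrable_const _) ?_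
    filter_upwards [ae_norm_le_uniformBall] with z hz
    have h1 := (le_abs_self _).trans (hf (y + z) y)
    rw [add_sub_cancel_left] at h1
    nlinarith
  simpa [ballSmoothing] using h

lemma hasGradientAt_ballSmoothing (hf : ∀ w w', |f w - f w'| ≤ L * ‖w - w'‖) (hL : 0 ≤ L)
    (hσ : 0 < σ) (y : EuclideanSpace ℝ (Fin d)) :
    HasGradientAt (ballSmoothing σ f) (ballGradient σ f y) y := by
  have := isProbabilityMeasure_uniformBall (d := d) hσ
  have hlip := lipschitzWith_toNNReal_of_abs_sub_le hf
  refine hasGradientAt_integral_shift (P := uniformBall d σ) (Z := id) (Φ := fun w _ => f w)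
    (Γ := fun w _ => gradient f w) (c := fun _ => L) (integrable_const L)
    (fun w => (integrable_shift_uniformBall hf hL hσ w).1)
    (fun w => (measurable_gradient_euclidean.comp (measurable_const_add w)).aestronglyMeasurable)
    (integrable_shift_uniformBall hf hL hσ) (Eventually.of_forall fun _ => hf) y ?_
  filter_upwards [ae_shift uniformBall_absolutelyContinuous
    (hlip.ae_differentiableAt (μ := (volume : Measure (EuclideanSpace ℝ (Fin d))))) y] with z hz
  exact hz.hasGradientAt

end smoothing

/-! ### The perturbed stochastic gradient: domination and unbiasedness. -/

section stochastic
variable {d p : ℕ} {F : EuclideanSpace ℝ (Fin d) → EuclideanSpace ℝ (Fin p) → ℝ}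
  {ν : Measure (EuclideanSpace ℝ (Fin p))} [IsProbabilityMeasure ν]
  {C : EuclideanSpace ℝ (Fin p) → ℝ}
  {G : EuclideanSpace ℝ (Fin d) → EuclideanSpace ℝ (Fin p) → EuclideanSpace ℝ (Fin d)} {σ : ℝ}

lemma ae_norm_approxGradient_le (hd : 0 < d) (hF : IsCaratheodory F)
    (hLip : ∀ᵐ t ∂ν, ∀ w w', |F w t - F w' t| ≤ C t * ‖w - w'‖)
    (hG : IsApproxStochGradient F ν G) (hσ : 0 < σ) (y : EuclideanSpace ℝ (Fin d)) :
    ∀ᵐ q ∂((uniformBall d σ).prod ν), ‖G (y + q.1) q.2‖ ≤ C q.2 := by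
  have := isProbabilityMeasure_uniformBall (d := d) hσ
  filter_upwards [ae_shift_of_ae_prod uniformBall_absolutelyContinuous (hG.ae_hasGradientAt hF hLip) y,
    (Measure.quasiMeasurePreserving_snd (μ := uniformBall d σ) (ν := ν)).ae hLip] with q h1 h2
  rw [← h1.gradient]
  exact norm_gradient_le_of_abs_sub_le hd h2 _

/-- The approximate stochastic gradient at a perturbed point is an unbiased estimator of the
gradient of the smoothed objective. -/
lemma integral_approxGradient_eq_ballGradient (hF : IsCaratheodory F)
    (hFint : ∀ w, Integrable (F w) ν) (hC : Integrable C ν)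
    (hLip : ∀ᵐ t ∂ν, ∀ w w', |F w t - F w' t| ≤ C t * ‖w - w'‖)
    (hL : 0 ≤ ∫ t, C t ∂ν)
    (hG : IsApproxStochGradient F ν G) (hσ : 0 < σ) (y : EuclideanSpace ℝ (Fin d)) :
    ∫ q, G (y + q.1) q.2 ∂((uniformBall d σ).prod ν) = ballGradient σ (objective F ν) y := by
  have := isProbabilityMeasure_uniformBall (d := d) hσ
  have hlipP := (Measure.quasiMeasurePreserving_snd (μ := uniformBall d σ) (ν := ν)).ae hLip
  have hsh : ∀ w : EuclideanSpace ℝ (Fin d), Measurable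
      fun q : EuclideanSpace ℝ (Fin d) × EuclideanSpace ℝ (Fin p) => (w + q.1, q.2) :=
    fun w => (measurable_fst.const_add w).prodMk measurable_snd
  have hint : ∀ w, Integrable (fun q : EuclideanSpace ℝ (Fin d) × EuclideanSpace ℝ (Fin p) =>
      F (w + q.1) q.2) ((uniformBall d σ).prod ν) := by
    intro w
    have hb : Integrable (fun q : EuclideanSpace ℝ (Fin d) × EuclideanSpace ℝ (Fin p) =>
        |F w q.2| + |C q.2| * σ) ((uniformBall d σ).prod ν) :=
      ((hFint w).abs.comp_snd _).add ((hC.abs.comp_snd _).mul_const σ)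
    refine hb.mono' (hF.measurable_uncurry.comp (hsh w)).aestronglyMeasurable ?_
    filter_upwards [hlipP, (Measure.quasiMeasurePreserving_fst (μ := uniformBall d σ)
      (ν := ν)).ae ae_norm_le_uniformBall] with q h1 h2
    have h3 := h1 (w + q.1) w
    rw [add_sub_cancel_left] at h3
    have h4 := abs_sub_abs_le_abs_sub (F (w + q.1) q.2) (F w q.2)
    have h5 : C q.2 * ‖q.1‖ ≤ |C q.2| * σ :=
      mul_le_mul (le_abs_self _) h2 (norm_nonneg _) (abs_nonneg _)
    rw [Real.norm_eq_abs]
    linarith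
  have h1 := hasGradientAt_integral_shift (P := (uniformBall d σ).prod ν) (Z := Prod.fst)
    (Φ := fun w q => F w q.2) (Γ := fun w q => G w q.2) (c := fun q => C q.2) (hC.comp_snd _)
    (fun w => (hint w).1) (fun w => (hG.measurable.comp (hsh w)).aestronglyMeasurable) hint hlipP y
    (ae_shift_of_ae_prod uniformBall_absolutelyContinuous (hG.ae_hasGradientAt hF hLip) y)
  -- By Fubini both sides are gradients of the same function, so uniqueness of the gradient
  -- identifies them.
  have h2 : (fun w => ∫ q, F (w + q.1) q.2 ∂((uniformBall d σ).prod ν)) =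
      ballSmoothing σ (objective F ν) := by
    funext w
    rw [integral_prod _ (hint w)]
    rfl
  rw [h2] at h1
  exact h1.unique (hasGradientAt_ballSmoothing (abs_objective_sub_le hFint hC hLip) hL hσ y)

end stochastic

/-! ### From a run of the algorithm to abstract SGD. -/

section run
variable {d p : ℕ} {Ω : Type*} {K S : ℕ} {z : ℕ → Fin S → Ω → EuclideanSpace ℝ (Fin d)}
  {ξ : ℕ → Fin S → Ω → EuclideanSpace ℝ (Fin p)}

/-- The pairs of perturbation and sample, extended by a constant to all indices. -/
def samplePair (K : ℕ) (z : ℕ → Fin S → Ω → EuclideanSpace ℝ (Fin d))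
    (ξ : ℕ → Fin S → Ω → EuclideanSpace ℝ (Fin p)) (k : ℕ) (l : Fin S) (ω : Ω) :
    EuclideanSpace ℝ (Fin d) × EuclideanSpace ℝ (Fin p) :=
  if k ∈ Set.Ico 1 K then (z k l ω, ξ k l ω) else (0, 0)

lemma samplePair_of_mem {k : ℕ} (hk : k ∈ Set.Ico 1 K) (l : Fin S) :
    samplePair K z ξ k l = fun ω => (z k l ω, ξ k l ω) := by
  funext ω; exact if_pos hk

lemma samplePair_family_eq : (fun (i : Set.Ico 1 K × Fin S) (ω : Ω) => samplePair K z ξ i.1 i.2 ω) =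
    fun i ω => (z i.1 i.2 ω, ξ i.1 i.2 ω) := by
  funext i; exact samplePair_of_mem i.1.2 i.2

variable [MeasurableSpace Ω] {μ : Measure Ω}
  {G : EuclideanSpace ℝ (Fin d) → EuclideanSpace ℝ (Fin p) → EuclideanSpace ℝ (Fin d)}
  {ν : Measure (EuclideanSpace ℝ (Fin p))} {x₁ : EuclideanSpace ℝ (Fin d)}
  {η σ : ℝ} {R : Ω → ℕ} {x : ℕ → Ω → EuclideanSpace ℝ (Fin d)}

lemma IsPISGDRun.measurable_samplePair (h : IsPISGDRun μ G ν x₁ K S η σ R z ξ x) (k : ℕ)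
    (l : Fin S) : Measurable (samplePair K z ξ k l) := by
  by_cases hk : k ∈ Set.Ico 1 K
  · rw [samplePair_of_mem hk]
    exact (h.measurable_z k hk l).prodMk (h.measurable_ξ k hk l)
  · have : samplePair K z ξ k l = fun _ => (0, 0) := by
      funext ω; exact if_neg hk
    rw [this]
    exact measurable_const

lemma IsPISGDRun.map_samplePair [IsProbabilityMeasure μ] (h : IsPISGDRun μ G ν x₁ K S η σ R z ξ x) (k : ℕ)
    (hk : k ∈ Set.Ico 1 K) (l : Fin S) :
    μ.map (samplePair K z ξ k l) = (uniformBall d σ).prod ν := by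
  rw [samplePair_of_mem hk, (indepFun_iff_map_prod_eq_prod_map_map
    (h.measurable_z k hk l).aemeasurable (h.measurable_ξ k hk l).aemeasurable).1
      (h.indep_z_ξ k hk l), h.law_z k hk l, h.law_ξ k hk l]
  rfl

lemma IsPISGDRun.iIndepFun_samplePair (h : IsPISGDRun μ G ν x₁ K S η σ R z ξ x) :
    iIndepFun (fun (i : Set.Ico 1 K × Fin S) ω => samplePair K z ξ i.1 i.2 ω) μ := by
  rw [samplePair_family_eq]; exact h.indep_pairs

lemma IsPISGDRun.indepFun_samplePair (h : IsPISGDRun μ G ν x₁ K S η σ R z ξ x) :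
    IndepFun R (fun ω (i : Set.Ico 1 K × Fin S) => samplePair K z ξ i.1 i.2 ω) μ := by
  have e : (fun ω (i : Set.Ico 1 K × Fin S) => samplePair K z ξ i.1 i.2 ω) =
      fun ω (i : Set.Ico 1 K × Fin S) => (z i.1 i.2 ω, ξ i.1 i.2 ω) := by
    funext ω i; exact if_pos i.1.2
  rw [e]; exact h.indep_R

/-- The run counts from 1 and `sgdIterate` from 0; they agree only up to the random index, beyond
which `x` is unconstrained. -/
lemma IsPISGDRun.eq_sgdIterate (h : IsPISGDRun μ G ν x₁ K S η σ R z ξ x) (ω : Ω) (hR : R ω ≤ K)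
    (n : ℕ) (hn : n < R ω) :
    x (n + 1) ω = sgdIterate (fun y q => G (y + q.1) q.2) η x₁
      (fun k l => samplePair K z ξ k l ω) n := by
  induction n with
  | zero => exact h.init ω
  | succ n ih =>
    have hk : n + 1 ∈ Set.Ico 1 K := ⟨by omega, by omega⟩
    rw [h.step ω (n + 1) (by omega) hn, ih (by omega), sgdIterate, sgdStep]
    simp_rw [samplePair_of_mem hk]

lemma IsPISGDRun.ae_output_eq (h : IsPISGDRun μ G ν x₁ K S η σ R z ξ x) :
    ∀ᵐ ω ∂μ, x (R ω) ω = sgdIterate (fun y q => G (y + q.1) q.2) η x₁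
      (fun k l => samplePair K z ξ k l ω) (R ω - 1) := by
  have hmem : ∀ᵐ k ∂(μ.map R), k ∈ Set.Icc 1 K := by
    rw [h.law_R, uniformOn]
    exact ae_cond_mem (Set.finite_Icc 1 K).measurableSet
  filter_upwards [ae_of_ae_map h.measurable_R.aemeasurable hmem] with ω hω
  rw [← h.eq_sgdIterate ω hω.2 (R ω - 1) (by have := hω.1; omega), Nat.sub_add_cancel hω.1]

end run

section
variable {d p : ℕ} {ν : Measure (EuclideanSpace ℝ (Fin p))}
  {F : EuclideanSpace ℝ (Fin d) → EuclideanSpace ℝ (Fin p) → ℝ}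
  {C : EuclideanSpace ℝ (Fin p) → ℝ}
  {G : EuclideanSpace ℝ (Fin d) → EuclideanSpace ℝ (Fin p) → EuclideanSpace ℝ (Fin d)}
  {K S : ℕ} {σ η m : ℝ} {x₁ : EuclideanSpace ℝ (Fin d)}
  {Ω : Type*} [MeasurableSpace Ω] {μ : Measure Ω}
  {R : Ω → ℕ} {z : ℕ → Fin S → Ω → EuclideanSpace ℝ (Fin d)}
  {ξ : ℕ → Fin S → Ω → EuclideanSpace ℝ (Fin p)} {x : ℕ → Ω → EuclideanSpace ℝ (Fin d)}

lemma IsPISGDRun.aemeasurable_output (hrun : IsPISGDRun μ G ν x₁ K S η σ R z ξ x)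
    (hG : IsApproxStochGradient F ν G) : AEMeasurable (fun ω => x (R ω) ω) μ := by
  have hH := hG.measurable_uncurry_shift
  refine ⟨fun ω => sgdIterate (fun y q => G (y + q.1) q.2) η x₁
    (fun k l => samplePair K z ξ k l ω) (R ω - 1), ?_, hrun.ae_output_eq⟩
  have hY : ∀ n, Measurable fun ω => sgdIterate (fun y q => G (y + q.1) q.2) η x₁
      (fun k l => samplePair K z ξ k l ω) n :=
    measurable_sgdIterate hH η x₁ hrun.measurable_samplePair
  -- Joint measurability is automatic in a countable index, so the random index may be substituted.
  have hpair : Measurable fun r : ℕ × Ω => sgdIterate (fun y q => G (y + q.1) q.2) η x₁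
      (fun k l => samplePair K z ξ k l r.2) r.1 := measurable_from_prod_countable_right hY
  exact hpair.comp (((measurable_of_countable fun n : ℕ => n - 1).comp
    hrun.measurable_R).prodMk measurable_id)

/-- The mean squared norm of the gradient of the smoothed objective at the output. -/
lemma IsPISGDRun.integral_norm_ballGradient_sq_le [IsProbabilityMeasure ν]
    [IsProbabilityMeasure μ] (hrun : IsPISGDRun μ G ν x₁ K S η σ R z ξ x)
    (hd : 0 < d) (hF : IsCaratheodory F) (hFint : ∀ w, Integrable (F w) ν) (hC : MemLp C 2 ν)
    (hLip : ∀ᵐ t ∂ν, ∀ w w', |F w t - F w' t| ≤ C t * ‖w - w'‖)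
    (hL : 0 < ∫ t, C t ∂ν) (hG : IsApproxStochGradient F ν G) (hK : 0 < K) (hS : 0 < S)
    (hσ : 0 < σ) (hη : 0 < η) (hησ : (∫ t, C t ∂ν) * √d / σ * η = 1)
    (hm : ∀ w, m ≤ objective F ν w) :
    ∫ ω, ‖ballGradient σ (objective F ν) (x (R ω) ω)‖ ^ 2 ∂μ ≤
      2 / (η * K) * (objective F ν x₁ + (∫ t, C t ∂ν) * σ - m) + (∫ t, C t ^ 2 ∂ν) / S := by
  have hτ := isProbabilityMeasure_uniformBall (d := d) hσ
  have hCi : Integrable C ν := hC.integrable one_le_two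
  have hfL := abs_objective_sub_le hFint hCi hLip
  have hH := hG.measurable_uncurry_shift
  have hgL := norm_ballGradient_sub_le hd hfL hσ
  have hgm := measurable_ballGradient hd hfL hσ
  have key := lintegral_norm_gradient_sgdIterate_le (P := (uniformBall d σ).prod ν) (μ := μ)
    (q := samplePair K z ξ) (x₁ := x₁) (H := fun y q => G (y + q.1) q.2)
    (c := fun q => C q.2) (m₀ := m) hK hS hη hησ (hasGradientAt_ballSmoothing hfL hL.le hσ) hgL hgm
    (le_ballSmoothing hfL hL.le hσ hm) hH (hC.comp_measurePreserving measurePreserving_snd)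
    (ae_norm_approxGradient_le hd hF hLip hG hσ)
    (integral_approxGradient_eq_ballGradient hF hFint hCi hLip hL.le hG hσ)
    hrun.measurable_samplePair hrun.map_samplePair hrun.iIndepFun_samplePair hrun.measurable_R
    hrun.law_R hrun.indepFun_samplePair
  have hQ : ∫ q, C q.2 ^ 2 ∂((uniformBall d σ).prod ν) = ∫ t, C t ^ 2 ∂ν := by
    simpa using integral_fun_snd (μ := uniformBall d σ) (ν := ν) (fun t => C t ^ 2)
  have hQ0 : 0 ≤ ∫ t, C t ^ 2 ∂ν := integral_nonneg fun t => sq_nonneg _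
  rw [hQ] at key
  have hK' : (0 : ℝ) < K := by exact_mod_cast hK
  have hS' : (0 : ℝ) < S := by exact_mod_cast hS
  have hA : 0 ≤ ballSmoothing σ (objective F ν) x₁ - m + K * (η / 2 * ((∫ t, C t ^ 2 ∂ν) / S)) :=
    add_nonneg (sub_nonneg.2 (le_ballSmoothing hfL hL.le hσ hm x₁)) (by positivity)
  have e : ∫⁻ ω, ENNReal.ofReal (η / 2 * ‖ballGradient σ (objective F ν) (x (R ω) ω)‖ ^ 2) ∂μ ≤
      ENNReal.ofReal ((K : ℝ)⁻¹ * (ballSmoothing σ (objective F ν) x₁ - m +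
        K * (η / 2 * ((∫ t, C t ^ 2 ∂ν) / S)))) := by
    rw [ENNReal.ofReal_mul (by positivity), ENNReal.ofReal_inv_of_pos hK', ENNReal.ofReal_natCast]
    refine le_trans (le_of_eq (lintegral_congr_ae ?_)) key
    filter_upwards [hrun.ae_output_eq] with ω hω
    rw [hω]
  have hYm : AEMeasurable (fun ω => ballGradient σ (objective F ν) (x (R ω) ω)) μ :=
    hgm.comp_aemeasurable (hrun.aemeasurable_output hG)
  have hreal : ∫ ω, η / 2 * ‖ballGradient σ (objective F ν) (x (R ω) ω)‖ ^ 2 ∂μ ≤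
      (K : ℝ)⁻¹ * (ballSmoothing σ (objective F ν) x₁ - m +
        K * (η / 2 * ((∫ t, C t ^ 2 ∂ν) / S))) := by
    rw [integral_eq_lintegral_of_nonneg_ae (Eventually.of_forall fun ω => by positivity)
      ((hYm.norm.pow_const 2).const_mul _).aestronglyMeasurable]
    exact ENNReal.toReal_le_of_le_ofReal (by positivity) e
  rw [integral_const_mul] at hreal
  have hφ := ballSmoothing_le hfL hL.le hσ x₁
  calc _ = 2 / η * (η / 2 * ∫ ω, ‖ballGradient σ (objective F ν) (x (R ω) ω)‖ ^ 2 ∂μ) := by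
        field_simp
    _ ≤ 2 / η * ((K : ℝ)⁻¹ * (objective F ν x₁ + (∫ t, C t ∂ν) * σ - m +
        K * (η / 2 * ((∫ t, C t ^ 2 ∂ν) / S)))) := by
        refine mul_le_mul_of_nonneg_left (hreal.trans ?_) (by positivity)
        gcongr
    _ = _ := by field_simp
end

/-! ### The convergence rate and the conclusion. -/

/-- The optimization term matches the rate exactly, and `S ≥ K^(1-β)` bounds the variance term by `Q
K^(β-1)`; strictness comes from the bound allowing `2Q` with `Q > 0`. -/
lemma rate_lt {K S : ℕ} (hK : 0 < K) {d : ℕ} {L₀ Q θ β σ η Δ : ℝ} (hL₀ : 0 < L₀) (hQ : 0 < Q)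
    (hθ : 0 < θ) (hS : S = ⌈(K : ℝ) ^ (1 - β)⌉₊)
    (hσ : σ = θ * √(d : ℝ) * (K : ℝ) ^ (-β)) (hη : η = θ / L₀ * (K : ℝ) ^ (-β)) :
    2 / (η * K) * (Δ + L₀ * σ) + Q / S <
      (K : ℝ) ^ (β - 1) * (2 * (L₀ / θ * Δ + L₀ ^ 2 * √(d : ℝ) * (K : ℝ) ^ (-β) + Q)) := by
  have hK' : (0 : ℝ) < K := by exact_mod_cast hK
  have hS1 : (K : ℝ) ^ (1 - β) ≤ S := hS ▸ Nat.le_ceil _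
  have hpos : 0 < (K : ℝ) ^ (1 - β) := Real.rpow_pos_of_pos hK' _
  have hinv : (K : ℝ) ^ (β - 1) = ((K : ℝ) ^ (1 - β))⁻¹ := by
    rw [← Real.rpow_neg hK'.le, neg_sub]
  have hpow : (K : ℝ) ^ (1 - β) = K * (K : ℝ) ^ (-β) := by
    rw [sub_eq_add_neg, Real.rpow_add hK', Real.rpow_one]
  have hQS : Q / S ≤ Q * (K : ℝ) ^ (β - 1) := by
    rw [hinv, ← div_eq_mul_inv]
    gcongr
  have hQ2 : Q * (K : ℝ) ^ (β - 1) < 2 * Q * (K : ℝ) ^ (β - 1) := by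
    have : 0 < Q * (K : ℝ) ^ (β - 1) := mul_pos hQ (Real.rpow_pos_of_pos hK' _)
    linarith
  have hκ : 0 < (K : ℝ) ^ (-β) := Real.rpow_pos_of_pos hK' _
  have hmain : 2 / (η * K) * (Δ + L₀ * σ) =
      (K : ℝ) ^ (β - 1) * (2 * (L₀ / θ * Δ + L₀ ^ 2 * √(d : ℝ) * (K : ℝ) ^ (-β))) := by
    rw [hinv, hpow, hη, hσ]
    generalize (K : ℝ) ^ (-β) = κ at hκ
    field_simp
  rw [hmain]
  linarith

end

theorem theorem1 {d p : ℕ} (hd : 0 < d)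
    -- the law of the random vector
    (ν : Measure (EuclideanSpace ℝ (Fin p))) [IsProbabilityMeasure ν]
    -- the loss, with finite expectation at every point
    (F : EuclideanSpace ℝ (Fin d) → EuclideanSpace ℝ (Fin p) → ℝ)
    (hF : IsCaratheodory F) (hFint : ∀ w, Integrable (F w) ν)
    -- the Lipschitz modulus, square integrable
    (C : EuclideanSpace ℝ (Fin p) → ℝ) (hC : MemLp C 2 ν)
    (hLip : ∀ᵐ ξ ∂ν, ∀ w w', |F w ξ - F w' ξ| ≤ C ξ * ‖w - w'‖)
    (L₀ Q : ℝ) (hL₀ : L₀ = ∫ ξ, C ξ ∂ν) (hL₀pos : 0 < L₀) (hQ : Q = ∫ ξ, C ξ ^ 2 ∂ν)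
    -- an approximate stochastic gradient
    (G : EuclideanSpace ℝ (Fin d) → EuclideanSpace ℝ (Fin p) → EuclideanSpace ℝ (Fin d))
    (hG : IsApproxStochGradient F ν G)
    -- the parameters
    (K : ℕ) (hK : 0 < K) (β θ : ℝ) (hβ : β ∈ Set.Ioo (0 : ℝ) 1) (hθ : 0 < θ)
    (S : ℕ) (hS : S = ⌈(K : ℝ) ^ (1 - β)⌉₊)
    (σ η : ℝ) (hσ : σ = θ * √(d : ℝ) * (K : ℝ) ^ (-β)) (hη : η = θ / L₀ * (K : ℝ) ^ (-β))
    -- the starting point, a global minimizer, and the initial gap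
    (x₁ xstar : EuclideanSpace ℝ (Fin d)) (hmin : ∀ w, objective F ν xstar ≤ objective F ν w)
    (Δ : ℝ) (hΔ : Δ = objective F ν x₁ - objective F ν xstar)
    -- a run of the algorithm
    {Ω : Type*} [MeasurableSpace Ω] (μ : Measure Ω) [IsProbabilityMeasure μ]
    (R : Ω → ℕ) (z : ℕ → Fin S → Ω → EuclideanSpace ℝ (Fin d))
    (ξ : ℕ → Fin S → Ω → EuclideanSpace ℝ (Fin p)) (x : ℕ → Ω → EuclideanSpace ℝ (Fin d))
    (hrun : IsPISGDRun μ G ν x₁ K S η σ R z ξ x)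
    -- the null set avoided in the definition of the Clarke subdifferential
    (N : Set (EuclideanSpace ℝ (Fin d))) (hN : volume N = 0) :
    (∀ w, (clarkeEpsSubdifferential N σ (objective F ν) w).Nonempty) ∧
    Integrable (fun ω =>
      Metric.infDist 0 (clarkeEpsSubdifferential N σ (objective F ν) (x (R ω) ω))) μ ∧
    ∫ ω, Metric.infDist 0 (clarkeEpsSubdifferential N σ (objective F ν) (x (R ω) ω)) ∂μ <
      (K : ℝ) ^ ((β - 1) / 2) *
        √(2 * (L₀ / θ * Δ + L₀ ^ 2 * √(d : ℝ) * (K : ℝ) ^ (-β) + Q)) := by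
  have hK' : (0 : ℝ) < K := by exact_mod_cast hK
  have hd' : (0 : ℝ) < √(d : ℝ) := Real.sqrt_pos.2 (by exact_mod_cast hd)
  have hκ : 0 < (K : ℝ) ^ (-β) := Real.rpow_pos_of_pos hK' _
  have hσ0 : 0 < σ := by rw [hσ]; positivity
  have hη0 : 0 < η := by rw [hη]; positivity
  have hS0 : 0 < S := by
    rw [hS]; exact Nat.ceil_pos.2 (Real.rpow_pos_of_pos hK' _)
  -- The step size is the reciprocal of the Lipschitz constant of the smoothed gradient.
  have hησ : (∫ t, C t ∂ν) * √d / σ * η = 1 := by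
    rw [← hL₀, hσ, hη]
    generalize (K : ℝ) ^ (-β) = κ at hκ
    field_simp
  have hCi : Integrable C ν := hC.integrable one_le_two
  -- Jensen gives `Q ≥ L₀² > 0`, which the strict inequality requires.
  have hQ0 : 0 < Q := by
    rw [hQ]
    refine lt_of_lt_of_le ?_ (sq_integral_le_integral_sq hC)
    rw [← hL₀]
    positivity
  have hfL := abs_objective_sub_le hFint hCi hLip
  have hτ := isProbabilityMeasure_uniformBall (d := d) hσ0
  have hne : ∀ w, (clarkeEpsSubdifferential N σ (objective F ν) w).Nonempty :=
    nonempty_clarkeEpsSubdifferential hfL hN uniformBall_absolutelyContinuous ae_norm_le_uniformBall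
  have hdist : ∀ w, Metric.infDist 0 (clarkeEpsSubdifferential N σ (objective F ν) w) ≤
      ‖ballGradient σ (objective F ν) w‖ :=
    infDist_clarkeEpsSubdifferential_le hd hfL hN uniformBall_absolutelyContinuous
      ae_norm_le_uniformBall
  have hgL := norm_ballGradient_le hd hfL hσ0
  have hout := hrun.aemeasurable_output hG
  have hgm := measurable_ballGradient hd hfL hσ0
  have hint : Integrable (fun ω =>
      Metric.infDist 0 (clarkeEpsSubdifferential N σ (objective F ν) (x (R ω) ω))) μ := by
    refine Integrable.of_bound
      ((lowerSemicontinuous_infDist_clarkeEpsSubdifferential hd hfL σ hne).measurable.comp_aemeasurable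
        hout).aestronglyMeasurable (∫ t, C t ∂ν) (Eventually.of_forall fun ω => ?_)
    rw [Real.norm_of_nonneg Metric.infDist_nonneg]
    exact (hdist _).trans (hgL _)
  refine ⟨hne, hint, ?_⟩
  have hgL2 : MemLp (fun ω => ‖ballGradient σ (objective F ν) (x (R ω) ω)‖) 2 μ :=
    MemLp.of_bound (hgm.norm.comp_aemeasurable hout).aestronglyMeasurable (∫ t, C t ∂ν)
      (Eventually.of_forall fun ω => by simpa using hgL (x (R ω) ω))
  have hbound := hrun.integral_norm_ballGradient_sq_le hd hF hFint hC hLip (hL₀ ▸ hL₀pos) hG hK hS0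
    hσ0 hη0 hησ hmin
  rw [← hL₀, ← hQ, show objective F ν x₁ + L₀ * σ - objective F ν xstar = Δ + L₀ * σ by
    rw [hΔ]; ring] at hbound
  have hrate := rate_lt (β := β) (Δ := Δ) hK hL₀pos hQ0 hθ hS hσ hη
  -- Jensen again: the squared mean of the gradient norm is at most its second moment.
  have hsq := (sq_integral_le_integral_sq hgL2).trans_lt (hbound.trans_lt hrate)
  have hroot : (K : ℝ) ^ ((β - 1) / 2) = √((K : ℝ) ^ (β - 1)) := by
    rw [Real.sqrt_eq_rpow, ← Real.rpow_mul hK'.le]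
    congr 1
    ring
  rw [hroot, ← Real.sqrt_mul (Real.rpow_nonneg hK'.le _)]
  exact (integral_mono hint (hgL2.integrable one_le_two) fun ω => hdist _).trans_lt
    (Real.lt_sqrt_of_sq_lt hsq)
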